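/- Let $a_n>0$ and $b_n\in\mathbb R$ ($n=0,1,2,\dots$) be bounded sequences such that $$\lim_{n\to\infty}\bigl(a_n-\tfrac12\bigr)=\lim_{n\to\infty}b_n=0,\qquad \sum_{n=0}^\infty\bigl(|a_{n+1}-a_n|+|b_{n+1}-b_n|\bigr)<\infty .$$ Let $J$ be the bounded self-adjoint Jacobi operator in $\ell^2(\mathbb Z_+)$, $(Ju)_0=b_0u_0+a_0u_1$, $(Ju)_n=a_{n-1}u_{n-1}+b_nu_n+a_nu_{n+1}$ ($n\ge1$), let $E(\lambda)=\mathbf 1_{(-\infty,\lambda]}(J)$ be its spectral family, $e_0,e_1,\dots$ the canonical basis, and $d\rho(\lambda)=d(E(\lambda)e_0,e_0)$ its spectral measure. Put $a_{-1}=\tfrac12$ and consider the equation $$a_{n-1}g_{n-1}+b_ng_n+a_ng_{n+1}=zg_n,\qquad n=0,1,2,\dots,\tag{1}$$ for sequences $\{g_n\}_{n=-1}^\infty$. The polynomials $P_n(z)$ are the solution of (1) with $P_{-1}(z)=0$, $P_0(z)=1$; the Wronskian of two solutions of (1) is $\{f,g\}=a_n(f_ng_{n+1}-f_{n+1}g_n)$,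 which does not depend on $n\ge-1$. Let $\zeta(z)=z-\sqrt{z^2-1}$ for $z\in\mathbb C\setminus[-1,1]$, with $\sqrt{z^2-1}>0$ for $z>1$, and let $\zeta(x\pm i0)$ be its boundary values for real $x$, so that $\zeta(x\pm i0)=x\mp i\sqrt{1-x^2}$ if $|x|\le1$. For $z\in\mathbb C\setminus\mathbb R$, and for $z=\lambda\pm i0$ with $\lambda\in(-1,1)$, put $\zeta_n(z)=\zeta\bigl(\tfrac{z-b_n}{2a_n}\bigr)$ and $q_n(z)=\zeta_0(z)\cdots\zeta_{n-1}(z)$. For each such $z$ the equation (1) (with spectral parameter $\lambda$ if $z=\lambda\pm i0$) has exactly one solution $f(z)=\{f_n(z)\}_{n=-1}^\infty$ with $f_n(z)=q_n(z)(1+o(1))$ as $n\to\infty$, the Jost solution. Put $\Omega(z)=\{P(z),f(z)\}$. For $\lambda\in(-1,1)$, $\Omega(\lambda\pm i0)=\{P(\lambda),f(\lambda\pm i0)\}$ is the limit of $\Omega(z)$ as $z\to\lambda$ with $\pm\operatorname{Im}z>0$; the product $k(\lambda)=\prod_{m=0}^\infty|\zeta_m(\lambda\pm i0)|$ has only finitely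 many factors different from $1$; and the normalized Wronskian $\boldsymbol\Omega(\lambda\pm i0)=k(\lambda)^{-1}\Omega(\lambda\pm i0)$ does not vanish. For all $n,m\in\mathbb Z_+$ and $\lambda\in(-1,1)$, and for both signs, the function $(E(\cdot)e_n,e_m)$ is differentiable at $\lambda$ and $$\frac{d(E(\lambda)e_n,e_m)}{d\lambda}=(2\pi)^{-1}\sqrt{1-\lambda^2}\,|\boldsymbol\Omega(\lambda\pm i0)|^{-2}P_n(\lambda)P_m(\lambda).$$ In particular, on $(-1,1)$ the spectral measure of $J$ is $d\rho(\lambda)=w(\lambda)\,d\lambda$ with $$w(\lambda)=(2\pi)^{-1}\sqrt{1-\lambda^2}\,|\boldsymbol\Omega(\lambda\pm i0)|^{-2},$$ where the right-hand sides do not depend on the sign. -/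

import Mathlib

open Filter Topology MeasureTheory Set
open scoped ENNReal ComplexConjugate

noncomputable section

namespace JacobiScattering

/-! ### The spectral family of a bounded self-adjoint operator -/

section SpectralFamily

variable {H : Type*} [NormedAddCommGroup H] [InnerProductSpace ℂ H] [CompleteSpace H]

/-- The spectral family `E(t) = 1_{(-∞, t]}(T)` of a bounded self-adjoint operator `T`: `E(t)` is
the orthogonal projection onto the kernel of the positive part `(T - t)₊`, where
`(T - t)₊ = g(T)` with `g(x) = max (x - t) 0`, through the continuous functional calculus. -/
def spectralFamily (T : H →L[ℂ] H) (t : ℝ) : H →L[ℂ] H :=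
  (cfc (fun x : ℝ => max (x - t) 0) T).ker.starProjection

theorem ker_posPart_mono (T : H →L[ℂ] H) {s t : ℝ} (hst : s ≤ t) :
    (cfc (fun x : ℝ => max (x - s) 0) T).ker ≤ (cfc (fun x : ℝ => max (x - t) 0) T).ker := by
  rcases hst.eq_or_lt with rfl | hlt
  · exact le_rfl
  have hpos : ∀ x : ℝ, max (x - s) (t - s) ≠ 0 := fun x =>
    ne_of_gt (lt_of_lt_of_le (sub_pos.2 hlt) (le_max_right _ _))
  have hcont : Continuous fun x : ℝ => max (x - t) 0 / max (x - s) (t - s) :=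
    Continuous.div (by fun_prop) (by fun_prop) hpos
  have hfac : (fun x : ℝ => max (x - t) 0) =
      fun x => (max (x - t) 0 / max (x - s) (t - s)) * max (x - s) 0 := by
    funext x
    rcases le_total x t with h | h
    · simp [max_eq_right (sub_nonpos.2 h)]
    · have h1 : max (x - s) (t - s) = x - s := max_eq_left (by linarith)
      have h2 : max (x - s) 0 = x - s := max_eq_left (by linarith)
      have h3 : x - s ≠ 0 := by intro h4; linarith
      rw [h1, h2, div_mul_cancel₀ _ h3]
  intro u hu
  have hu' : cfc (fun x : ℝ => max (x - s) 0) T u = 0 := hu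
  change cfc (fun x : ℝ => max (x - t) 0) T u = 0
  rw [hfac, cfc_mul (fun x : ℝ => max (x - t) 0 / max (x - s) (t - s)) (fun x => max (x - s) 0)
    T hcont.continuousOn (by fun_prop)]
  change cfc (fun x : ℝ => max (x - t) 0 / max (x - s) (t - s)) T
    (cfc (fun x : ℝ => max (x - s) 0) T u) = 0
  rw [hu', map_zero]

theorem spectralFamily_mono (T : H →L[ℂ] H) (u : H) :
    Monotone fun t : ℝ => RCLike.re (inner ℂ u (spectralFamily T t u)) := by
  intro s t hst
  have hn : ∀ r, RCLike.re (inner ℂ u (spectralFamily T r u)) = ‖spectralFamily T r u‖ ^ 2 := by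
    intro r
    rw [← inner_conj_symm, RCLike.conj_re]
    exact Submodule.re_inner_starProjection_eq_normSq _ _
  have h2 : spectralFamily T s u = spectralFamily T s (spectralFamily T t u) := by
    have := Submodule.starProjection_comp_starProjection_of_le (ker_posPart_mono T hst)
    exact (congrArg (fun A => A u) this).symm
  simp only [hn]
  rw [h2]
  gcongr
  exact Submodule.norm_starProjection_apply_le _ _

/-- The spectral measure `d(E(t) u, u)` of the vector `u`, as the Lebesgue–Stieltjes measure of the
monotone (right-continuous) function `t ↦ (E(t) u, u)`. -/
def spectralMeasureOf (T : H →L[ℂ] H) (u : H) : Measure ℝ :=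
  (spectralFamily_mono T u).stieltjesFunction.measure

end SpectralFamily

/-! ### Jacobi coefficients -/

/-- Bounded Jacobi coefficients: the off-diagonal entries `a n > 0` and the real diagonal entries
`b n`, `n = 0, 1, 2, …`. -/
structure Coeffs where
  a : ℕ → ℝ
  b : ℕ → ℝ
  a_pos : ∀ n, 0 < a n
  bounded : ∃ C : ℝ, ∀ n, |a n| ≤ C ∧ |b n| ≤ C

/-- The Hilbert space `ℓ²(ℤ₊)` of complex sequences. -/
abbrev ell2 : Type := lp (fun _ : ℕ => ℂ) 2

/-- The canonical basis vectors `e_0, e_1, …` of `ℓ²(ℤ₊)`. -/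
def e (n : ℕ) : ell2 := lp.single 2 n (1 : ℂ)

namespace Coeffs

variable (c : Coeffs)

/-- `c.aPrev n` is `a_{n-1}`, with the convention `a_{-1} = 1/2`. -/
def aPrev : ℕ → ℝ
  | 0 => 1 / 2
  | n + 1 => c.a n

/-! ### The Jacobi operator -/

/-- The formal action of the Jacobi matrix:
`(Ju)_0 = b_0 u_0 + a_0 u_1`, `(Ju)_n = a_{n-1} u_{n-1} + b_n u_n + a_n u_{n+1}` for `n ≥ 1`. -/
def matrixAction (u : ℕ → ℂ) : ℕ → ℂ
  | 0 => c.b 0 * u 0 + c.a 0 * u 1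
  | n + 1 => c.a n * u n + c.b (n + 1) * u (n + 1) + c.a (n + 1) * u (n + 2)

theorem norm_matrixAction_sq_le {C : ℝ} (hC : ∀ n, |c.a n| ≤ C ∧ |c.b n| ≤ C)
    (u : ℕ → ℂ) (n : ℕ) :
    ‖c.matrixAction u n‖ ^ 2 ≤
      3 * C ^ 2 * (‖u (n - 1)‖ ^ 2 + ‖u n‖ ^ 2 + ‖u (n + 1)‖ ^ 2) := by
  have hC0 : 0 ≤ C := (abs_nonneg _).trans (hC 0).1
  have key : ‖c.matrixAction u n‖ ≤ C * ‖u (n - 1)‖ + C * ‖u n‖ + C * ‖u (n + 1)‖ := by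
    have hm : ∀ (r : ℝ) (w : ℂ), |r| ≤ C → ‖(r : ℂ) * w‖ ≤ C * ‖w‖ := by
      intro r w hr
      rw [norm_mul, Complex.norm_real, Real.norm_eq_abs]
      exact mul_le_mul_of_nonneg_right hr (norm_nonneg _)
    cases n with
    | zero =>
      have h1 := hm _ (u 0) (hC 0).2
      have h2 := hm _ (u 1) (hC 0).1
      have h3 := norm_add_le ((c.b 0 : ℂ) * u 0) (c.a 0 * u 1)
      have h4 : 0 ≤ C * ‖u 0‖ := by positivity
      simp only [matrixAction, Nat.zero_sub, zero_add]
      linarith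
    | succ n =>
      have h1 := hm _ (u n) (hC n).1
      have h2 := hm _ (u (n + 1)) (hC (n + 1)).2
      have h3 := hm _ (u (n + 2)) (hC (n + 1)).1
      have h4 := norm_add₃_le (a := (c.a n : ℂ) * u n) (b := c.b (n + 1) * u (n + 1))
        (c := c.a (n + 1) * u (n + 2))
      simp only [matrixAction, Nat.add_sub_cancel]
      linarith
  have h0 := norm_nonneg (c.matrixAction u n)
  calc ‖c.matrixAction u n‖ ^ 2
      ≤ (C * ‖u (n - 1)‖ + C * ‖u n‖ + C * ‖u (n + 1)‖) ^ 2 := by gcongr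
    _ ≤ 3 * C ^ 2 * (‖u (n - 1)‖ ^ 2 + ‖u n‖ ^ 2 + ‖u (n + 1)‖ ^ 2) := by
      nlinarith [sq_nonneg (C * ‖u (n - 1)‖ - C * ‖u n‖),
        sq_nonneg (C * ‖u (n - 1)‖ - C * ‖u (n + 1)‖), sq_nonneg (C * ‖u n‖ - C * ‖u (n + 1)‖)]

theorem summable_norm_sq (u : ell2) : Summable fun n => ‖u n‖ ^ 2 := by
  have h := (lp.memℓp u).summable (p := 2) (by norm_num)
  simpa using h

theorem summable_bound (u : ell2) :
    Summable fun n : ℕ => ‖u (n - 1)‖ ^ 2 + ‖u n‖ ^ 2 + ‖u (n + 1)‖ ^ 2 := by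
  have h := summable_norm_sq u
  refine Summable.add (Summable.add ?_ h) ?_
  · refine (summable_nat_add_iff 1).1 ?_
    simpa using h
  · exact (summable_nat_add_iff (f := fun n => ‖u n‖ ^ 2) 1).2 h

theorem memℓp_matrixAction (u : ell2) : Memℓp (c.matrixAction u) 2 := by
  obtain ⟨C, hC⟩ := c.bounded
  refine memℓp_gen ?_
  have h := (summable_bound u).mul_left (3 * C ^ 2)
  refine Summable.of_nonneg_of_le (fun n => by positivity) (fun n => ?_) h
  simpa using c.norm_matrixAction_sq_le hC u n

/-- The Jacobi operator as a linear map on `ℓ²(ℤ₊)`. -/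
def jacobiLin : ell2 →ₗ[ℂ] ell2 where
  toFun u := ⟨c.matrixAction u, c.memℓp_matrixAction u⟩
  map_add' u v := by
    ext n
    change c.matrixAction (u + v : ell2) n = c.matrixAction u n + c.matrixAction v n
    cases n <;> simp only [matrixAction, lp.coeFn_add, Pi.add_apply] <;> ring
  map_smul' r u := by
    ext n
    change c.matrixAction (r • u : ell2) n = r * c.matrixAction u n
    cases n <;> simp only [matrixAction, lp.coeFn_smul, Pi.smul_apply, smul_eq_mul] <;> ring

theorem jacobiLin_apply (u : ell2) (n : ℕ) : c.jacobiLin u n = c.matrixAction u n := rfl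

theorem jacobiLin_isSymmetric : c.jacobiLin.IsSymmetric := by
  intro u v
  have hs := lp.summable_inner (𝕜 := ℂ) (c.jacobiLin u) v
  have ht := lp.summable_inner (𝕜 := ℂ) u (c.jacobiLin v)
  rw [lp.inner_eq_tsum, lp.inner_eq_tsum]
  -- the partial sums of the difference telescope to a boundary term that tends to zero
  have hpart : ∀ N : ℕ, (∑ n ∈ Finset.range (N + 1), inner ℂ (c.jacobiLin u n) (v n)) -
      (∑ n ∈ Finset.range (N + 1), inner ℂ (u n) (c.jacobiLin v n)) =
      c.a N * (conj (u (N + 1)) * v N - conj (u N) * v (N + 1)) := by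
    intro N
    induction N with
    | zero =>
      simp [jacobiLin_apply, matrixAction]
      ring
    | succ N ih =>
      rw [Finset.sum_range_succ, Finset.sum_range_succ (n := N + 1), add_sub_add_comm, ih]
      simp [jacobiLin_apply, matrixAction]
      ring
  have hl := (hs.hasSum.tendsto_sum_nat.sub ht.hasSum.tendsto_sum_nat).comp (tendsto_add_atTop_nat 1)
  have h0 : Tendsto (fun N : ℕ => (c.a N : ℂ) * (conj (u (N + 1)) * v N - conj (u N) * v (N + 1)))
      atTop (𝓝 0) := by
    have hz : ∀ w : ell2, Tendsto (fun n => w n) atTop (𝓝 0) := by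
      intro w
      have h1 := (summable_norm_sq w).tendsto_atTop_zero
      rw [tendsto_zero_iff_norm_tendsto_zero]
      have h2 := h1.sqrt
      simpa using h2
    have hu := hz u
    have hv := hz v
    have hu1 := hu.comp (tendsto_add_atTop_nat 1)
    have hv1 := hv.comp (tendsto_add_atTop_nat 1)
    have hcu := (Complex.continuous_conj.tendsto 0).comp hu
    have hcu1 := (Complex.continuous_conj.tendsto 0).comp hu1
    have h3 := (hcu1.mul hv).sub (hcu.mul hv1)
    obtain ⟨C, hC⟩ := c.bounded
    refine Tendsto.zero_mul_isBoundedUnder_le (f := fun N : ℕ =>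
      (conj (u (N + 1)) * v N - conj (u N) * v (N + 1))) (g := fun N => (c.a N : ℂ))
      (by simpa using h3) ?_ |>.congr fun N => mul_comm _ _
    refine isBoundedUnder_of ⟨C, fun n => ?_⟩
    simpa using (hC n).1
  have := tendsto_nhds_unique (hl.congr fun N => hpart N) h0
  exact sub_eq_zero.1 this

/-- The Jacobi operator `J`, a bounded self-adjoint operator on `ℓ²(ℤ₊)`. -/
def jacobiOp : ell2 →L[ℂ] ell2 :=
  ⟨c.jacobiLin, c.jacobiLin_isSymmetric.continuous⟩

theorem jacobiOp_apply (u : ell2) (n : ℕ) : c.jacobiOp u n = c.matrixAction u n := rfl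

theorem jacobiOp_isSelfAdjoint : IsSelfAdjoint c.jacobiOp :=
  ContinuousLinearMap.isSelfAdjoint_iff_isSymmetric.2 c.jacobiLin_isSymmetric

/-- The spectral measure `dρ(t) = d(E(t) e_0, e_0)` of the Jacobi operator. -/
def spectralMeasure : Measure ℝ := spectralMeasureOf c.jacobiOp (e 0)

/-! ### Solutions of the Jacobi difference equation -/

/-- Sequences `g = {g_n}` with `n = -1, 0, 1, …` are represented by functions on `ℕ` whose value
at `k` is `g_{k-1}`. The Jacobi equation is
`a_{n-1} g_{n-1} + b_n g_n + a_n g_{n+1} = z g_n` for `n = 0, 1, …`. -/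
def IsSolution (z : ℂ) (g : ℕ → ℂ) : Prop :=
  ∀ n : ℕ, c.aPrev n * g n + c.b n * g (n + 1) + c.a n * g (n + 2) = z * g (n + 1)

/-- The polynomial solution `P(z)` of the Jacobi equation, fixed by `P_{-1}(z) = 0` and
`P_0(z) = 1`; index shifted, so that the value at `k` is `P_{k-1}(z)`. -/
def polySolution (z : ℂ) : ℕ → ℂ
  | 0 => 0
  | 1 => 1
  | n + 2 => ((z - c.b n) * polySolution z (n + 1) - c.aPrev n * polySolution z n) / c.a n

/-- The orthonormal polynomial `P_n(z)`, `n = 0, 1, …`. -/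
def P (n : ℕ) (z : ℂ) : ℂ := c.polySolution z (n + 1)

theorem polySolution_isSolution (z : ℂ) : c.IsSolution z (c.polySolution z) := by
  intro n
  have h : (c.a n : ℂ) ≠ 0 := by exact_mod_cast (c.a_pos n).ne'
  rw [polySolution]
  field_simp
  ring

/-- The expression `a_n (f_n g_{n+1} - f_{n+1} g_n)` at `n = k - 1`. -/
def wronskianAt (f g : ℕ → ℂ) (k : ℕ) : ℂ :=
  c.aPrev k * (f k * g (k + 1) - f (k + 1) * g k)

/-- For two solutions of the Jacobi equation it does not depend on the index. -/
theorem wronskianAt_eq {z : ℂ} {f g : ℕ → ℂ} (hf : c.IsSolution z f) (hg : c.IsSolution z g)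
    (k : ℕ) : c.wronskianAt f g k = c.wronskianAt f g 0 := by
  induction k with
  | zero => rfl
  | succ k ih =>
    rw [← ih]
    have h1 := hf k
    have h2 := hg k
    simp only [wronskianAt]
    change (c.a k : ℂ) * _ = _
    linear_combination f (k + 1) * h2 - g (k + 1) * h1

/-- The Wronskian `{f, g}` of two solutions of the Jacobi equation. -/
def wronskian (f g : ℕ → ℂ) : ℂ := c.wronskianAt f g 0

/-- `f` is the (modified) Jost solution of the Jacobi equation at `z` for the sequence `ζ_0, ζ_1, …`:
it solves the equation and `f_n = q_n (1 + o(1))` as `n → ∞`, where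
`q_n = ζ_0 ζ_1 ⋯ ζ_{n-1}`. -/
def IsJostSolution (ζ : ℕ → ℂ) (z : ℂ) (f : ℕ → ℂ) : Prop :=
  c.IsSolution z f ∧
    Tendsto (fun n : ℕ => f (n + 1) / ∏ m ∈ Finset.range n, ζ m) atTop (𝓝 1)

/-- The Jost solution, chosen among the sequences with the property `IsJostSolution`
(an arbitrary sequence if there is none). -/
def jost (ζ : ℕ → ℂ) (z : ℂ) : ℕ → ℂ := Classical.epsilon (c.IsJostSolution ζ z)

end Coeffs

/-! ### The function `ζ` and its values on the two edges of the cut -/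

/-- The branch of `√(z² - 1)` on `ℂ ∖ [-1, 1]` that is positive for `z > 1`; it is the product of
the principal branches of `√(z - 1)` and `√(z + 1)`. -/
def sqrtSqSubOne (z : ℂ) : ℂ := (z - 1) ^ (1 / 2 : ℂ) * (z + 1) ^ (1 / 2 : ℂ)

/-- `ζ(z) = z - √(z² - 1)` for `z ∈ ℂ ∖ [-1, 1]`. -/
def zeta (z : ℂ) : ℂ := z - sqrtSqSubOne z

/-- The two edges of the cut along the real axis: `upper` stands for `+ i0`,
`lower` for `- i0`. -/
inductive Edge
  | upper
  | lower

/-- The sign of an edge. -/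
def Edge.sign : Edge → ℝ
  | upper => 1
  | lower => -1

/-- The open half-plane adjacent to an edge. -/
def Edge.halfPlane (s : Edge) : Set ℂ := {z : ℂ | 0 < s.sign * z.im}

/-- `ζ(x ± i0)` for real `x`: this is `x ∓ i √(1 - x²)` for `x ∈ [-1, 1]`, and `ζ(x)` otherwise. -/
def zetaEdge (s : Edge) (x : ℝ) : ℂ :=
  if |x| ≤ 1 then (x : ℂ) - s.sign * Complex.I * Real.sqrt (1 - x ^ 2) else zeta x

namespace Coeffs

variable (c : Coeffs)

/-- `ζ_n(z) = ζ((z - b_n) / (2 a_n))` for `z` off the real axis. -/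
def zetaSeq (z : ℂ) (n : ℕ) : ℂ := zeta ((z - c.b n) / (2 * c.a n))

/-- `ζ_n(x ± i0)` for real `x`. -/
def zetaSeqEdge (s : Edge) (x : ℝ) (n : ℕ) : ℂ := zetaEdge s ((x - c.b n) / (2 * c.a n))

/-- The Wronskian `Ω(z) = {P(z), f(z)}` for `z` off the real axis. -/
def Omega (z : ℂ) : ℂ := c.wronskian (c.polySolution z) (c.jost (c.zetaSeq z) z)

/-- The Wronskian `Ω(x ± i0) = {P(x), f(x ± i0)}` for real `x`. -/
def OmegaEdge (s : Edge) (x : ℝ) : ℂ :=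
  c.wronskian (c.polySolution x) (c.jost (c.zetaSeqEdge s x) x)

/-- The product `k(x) = ∏_m |ζ_m(x ± i0)|`; for `x ∈ (-1, 1)`, `a_n → 1/2` and `b_n → 0` only
finitely many factors differ from `1`. -/
def kFactor (s : Edge) (x : ℝ) : ℝ := ∏ᶠ m : ℕ, ‖c.zetaSeqEdge s x m‖

/-- The normalized Wronskian `k(x)⁻¹ Ω(x ± i0)`. -/
def normOmega (s : Edge) (x : ℝ) : ℂ := ((c.kFactor s x : ℝ) : ℂ)⁻¹ * c.OmegaEdge s x

/-- The weight `w(x) = (2π)⁻¹ √(1 - x²) |Ω(x ± i0)|⁻²`, with the normalized Wronskian. -/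
def weight (s : Edge) (x : ℝ) : ℝ :=
  (2 * Real.pi)⁻¹ * Real.sqrt (1 - x ^ 2) * (‖c.normOmega s x‖ ^ 2)⁻¹

end Coeffs

end JacobiScattering

end

open JacobiScattering

/-! The proof computes the Weyl function f_0/Ω, which is the matrix element ((J - z)⁻¹e_0, e_0). For
nonreal z the Jost solution is square summable, and since Ω = -f_{-1}/2, dropping its value at n =
-1 turns the difference equation into (J - z)f = Ωe_0 (`jacobiOp_jostVec`). By Stone's formula
(`inner_functionalCalculus_eq_integral`) the density of (E(·)e_0, e_0) on the cut is ±π⁻¹ times the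
imaginary part of the boundary value of f_0/Ω. For real λ the conjugate of f(λ ± i0) solves the same
equation; comparing the Wronskian of the two at n = -1 and at infinity gives Im(conj f_{-1} · f_0) =
∓k²√(1 - λ²) (`im_conj_jostExt_mul`). This turns the imaginary part into the asserted weight, and it
also shows that Ω does not vanish on the cut. The other matrix elements follow from P_n(J)e_0 = e_n.

The analytic work lies in the continuity of f_n(z) up to the cut. By variation of constants, f_n =
q_n(x_n + y_n), f_{n+1} = q_n(ζ_n x_n + ζ_n⁻¹ y_n), and (x_n, y_n) is obtained from (x_{n+1},
y_{n+1}) by a linear map. For constant coefficients this map is (x, y) ↦ (x, ζ²y), a contraction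
fixing (1, 0). In general the error is of the order of the increments of a_n and b_n, locally
uniformly on `Edge.domain`, because ζ² ≠ 1 there. As the increments are summable,
`exists_backward_solution` yields amplitudes tending to (1, 0) and continuous in z. Each closed
half-plane is treated separately, with ζ extended to its boundary by `zetaExt`. -/

namespace JacobiScattering

/-! ### The function `ζ` on a closed half-plane -/

theorem Edge.sign_mul_self (s : Edge) : s.sign * s.sign = 1 := by
  cases s <;> simp [Edge.sign]

theorem cpow_half_mul_self (w : ℂ) : w ^ (1 / 2 : ℂ) * w ^ (1 / 2 : ℂ) = w := by
  have h := Complex.cpow_nat_inv_pow w (n := 2) two_ne_zero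
  rw [one_div, ← sq]
  exact_mod_cast h

theorem re_cpow_half_nonneg (w : ℂ) : 0 ≤ (w ^ (1 / 2 : ℂ)).re := by
  rcases eq_or_ne w 0 with rfl | hw
  · simp
  · rw [Complex.cpow_def_of_ne_zero hw, Complex.exp_re]
    refine mul_nonneg (Real.exp_pos _).le (Real.cos_nonneg_of_neg_pi_div_two_le_of_le ?_ ?_)
    · have := Complex.neg_pi_lt_arg w
      simp [Complex.mul_im, Complex.log_im]
      linarith
    · have := Complex.arg_le_pi w
      simp [Complex.mul_im, Complex.log_im]
      linarith

theorem im_cpow_half_nonneg {w : ℂ} (h : 0 ≤ w.im) : 0 ≤ (w ^ (1 / 2 : ℂ)).im := by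
  rcases eq_or_ne w 0 with rfl | hw
  · simp
  · rw [Complex.cpow_def_of_ne_zero hw, Complex.exp_im]
    refine mul_nonneg (Real.exp_pos _).le (Real.sin_nonneg_of_nonneg_of_le_pi ?_ ?_)
    · have := Complex.arg_nonneg_iff.2 h
      simp [Complex.mul_im, Complex.log_im]
      linarith
    · have := Complex.arg_le_pi w
      have := Real.pi_pos
      simp [Complex.mul_im, Complex.log_im]
      linarith

theorem im_eq_two_mul_cpow_half (w : ℂ) :
    w.im = 2 * ((w ^ (1 / 2 : ℂ)).re * (w ^ (1 / 2 : ℂ)).im) := by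
  conv_lhs => rw [← cpow_half_mul_self w]
  rw [Complex.mul_im]
  ring

theorem sqrtSqSubOne_mul_self (w : ℂ) : sqrtSqSubOne w * sqrtSqSubOne w = w ^ 2 - 1 := by
  have h1 := cpow_half_mul_self (w - 1)
  have h2 := cpow_half_mul_self (w + 1)
  unfold sqrtSqSubOne
  linear_combination (w + 1) * h1 + (w - 1) ^ (1 / 2 : ℂ) * (w - 1) ^ (1 / 2 : ℂ) * h2

theorem zeta_quadratic (w : ℂ) : zeta w ^ 2 + 1 = 2 * w * zeta w := by
  have h := sqrtSqSubOne_mul_self w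
  unfold zeta
  linear_combination h

/-- With A = √(w - 1) and B = √(w + 1), 2ζ = (A - B)² and (A - B)(A + B) = -2, so |ζ| ≤ 1 amounts to
|A - B| ≤ |A + B|, that is, to Re(A conj B) ≥ 0. Here p = |A - B|², q = |A + B|² and r = 4 Re(A conj
B). -/
theorem exists_norm_zeta_eq (w : ℂ) : ∃ r : ℝ, 0 ≤ r ∧ (w.im ≠ 0 → 0 < r) ∧ ∃ p q : ℝ, 0 ≤ p ∧
    p + r = q ∧ p * q = 4 ∧ ‖zeta w‖ * 2 = p := by
  set A := (w - 1) ^ (1 / 2 : ℂ) with hA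
  set B := (w + 1) ^ (1 / 2 : ℂ) with hB
  have hAA : A * A = w - 1 := cpow_half_mul_self _
  have hBB : B * B = w + 1 := cpow_half_mul_self _
  have hz : zeta w * 2 = (A - B) ^ 2 := by
    unfold zeta sqrtSqSubOne
    rw [← hA, ← hB]
    linear_combination -hAA - hBB
  have hprod : (A - B) * (A + B) = -2 := by linear_combination hAA - hBB
  have hAr : 0 ≤ A.re := re_cpow_half_nonneg _
  have hBr : 0 ≤ B.re := re_cpow_half_nonneg _
  have hAi : w.im = 2 * (A.re * A.im) := by
    have := im_eq_two_mul_cpow_half (w - 1)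
    rwa [Complex.sub_im, Complex.one_im, sub_zero] at this
  have hBi : w.im = 2 * (B.re * B.im) := by
    have := im_eq_two_mul_cpow_half (w + 1)
    rwa [Complex.add_im, Complex.one_im, add_zero] at this
  have hre : 0 ≤ A.re * B.re := mul_nonneg hAr hBr
  -- Both roots have nonnegative real part, so their imaginary parts follow the sign of Im w.
  have him : 0 ≤ A.im * B.im := by
    rcases le_or_gt 0 w.im with h | h
    · exact mul_nonneg (im_cpow_half_nonneg (by simpa using h))
        (im_cpow_half_nonneg (by simpa using h))
    · have h1 : A.im < 0 := by
        by_contra hc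
        have := mul_nonneg hAr (not_lt.1 hc)
        linarith
      have h2 : B.im < 0 := by
        by_contra hc
        have := mul_nonneg hBr (not_lt.1 hc)
        linarith
      exact (mul_pos_of_neg_of_neg h1 h2).le
  refine ⟨4 * (A.re * B.re + A.im * B.im), by positivity, fun hw => ?_, ‖A - B‖ ^ 2, ‖A + B‖ ^ 2,
    by positivity, ?_, ?_, ?_⟩
  · have h1 : A.re ≠ 0 := fun h => hw (by rw [hAi, h]; ring)
    have h2 : B.re ≠ 0 := fun h => hw (by rw [hBi, h]; ring)
    have h3 : 0 < A.re * B.re :=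
      mul_pos (lt_of_le_of_ne hAr h1.symm) (lt_of_le_of_ne hBr h2.symm)
    linarith
  · simp only [Complex.sq_norm, Complex.normSq_apply, Complex.sub_re, Complex.sub_im,
      Complex.add_re, Complex.add_im]
    ring
  · rw [← mul_pow, ← norm_mul, hprod]
    norm_num
  · have := congrArg norm hz
    simpa using this

theorem norm_zeta_le_one (w : ℂ) : ‖zeta w‖ ≤ 1 := by
  obtain ⟨r, hr, -, p, q, hp, hpq, h4, hz⟩ := exists_norm_zeta_eq w
  nlinarith

theorem norm_zeta_lt_one {w : ℂ} (hw : w.im ≠ 0) : ‖zeta w‖ < 1 := by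
  obtain ⟨r, hr, hr', p, q, hp, hpq, h4, hz⟩ := exists_norm_zeta_eq w
  have := hr' hw
  nlinarith

/-- Multiply the quadratic equation by conj ζ and take imaginary parts. If 0 < |ζ| < 1, then Im ζ
and Im w have opposite signs or both vanish. -/
theorem im_root_mul {w ζ : ℂ} (h : ζ ^ 2 + 1 = 2 * w * ζ) :
    ζ.im * (‖ζ‖ ^ 2 - 1) = 2 * w.im * ‖ζ‖ ^ 2 := by
  have h1 : ζ * (‖ζ‖ ^ 2 : ℝ) + conj ζ = 2 * w * (‖ζ‖ ^ 2 : ℝ) := by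
    rw [Complex.ofReal_pow, ← Complex.mul_conj']
    linear_combination conj ζ * h
  have h2 := congrArg Complex.im h1
  simp only [Complex.add_im, Complex.im_mul_ofReal, Complex.conj_im] at h2
  have h3 : (2 * w).im = 2 * w.im := by simp
  rw [h3] at h2
  linarith

/-- The boundary-value extension of `ζ` to the closed half-plane adjacent to an edge. -/
noncomputable def zetaExt (s : Edge) (w : ℂ) : ℂ :=
  if w.im = 0 then zetaEdge s w.re else zeta w

/-- The closed half-plane adjacent to an edge. -/
def Edge.closedHalfPlane (s : Edge) : Set ℂ := {z : ℂ | 0 ≤ s.sign * z.im}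

theorem zetaExt_ofReal (s : Edge) (x : ℝ) : zetaExt s x = zetaEdge s x := by
  simp [zetaExt]

theorem zetaExt_of_im_ne_zero (s : Edge) {w : ℂ} (h : w.im ≠ 0) : zetaExt s w = zeta w := by
  simp [zetaExt, h]

theorem zetaEdge_of_abs_le (s : Edge) {x : ℝ} (h : |x| ≤ 1) :
    zetaEdge s x = (x : ℂ) - s.sign * Complex.I * Real.sqrt (1 - x ^ 2) := by
  simp [zetaEdge, h]

theorem zetaEdge_quadratic (s : Edge) (x : ℝ) :
    zetaEdge s x ^ 2 + 1 = 2 * x * zetaEdge s x := by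
  by_cases h : |x| ≤ 1
  · rw [zetaEdge_of_abs_le s h]
    have h1 : 0 ≤ 1 - x ^ 2 := by
      have := (sq_le_one_iff_abs_le_one x).2 h
      linarith
    have h2 : ((Real.sqrt (1 - x ^ 2) : ℝ) : ℂ) ^ 2 = 1 - (x : ℂ) ^ 2 := by
      rw [← Complex.ofReal_pow, Real.sq_sqrt h1]
      push_cast
      ring
    have h3 : ((s.sign : ℝ) : ℂ) * s.sign = 1 := by exact_mod_cast s.sign_mul_self
    linear_combination (-(((Real.sqrt (1 - x ^ 2) : ℝ) : ℂ) ^ 2)) * h3 - h2 +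
      (s.sign : ℂ) ^ 2 * ((Real.sqrt (1 - x ^ 2) : ℝ) : ℂ) ^ 2 * Complex.I_sq
  · simp only [zetaEdge, h, if_false]
    exact zeta_quadratic _

theorem zetaExt_quadratic (s : Edge) (w : ℂ) :
    zetaExt s w ^ 2 + 1 = 2 * w * zetaExt s w := by
  by_cases h : w.im = 0
  · have hw : w = (w.re : ℂ) := Complex.ext rfl (by simpa using h)
    rw [hw, zetaExt_ofReal]
    exact zetaEdge_quadratic s _
  · rw [zetaExt_of_im_ne_zero s h]
    exact zeta_quadratic w

theorem zetaExt_ne_zero (s : Edge) (w : ℂ) : zetaExt s w ≠ 0 := by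
  intro h
  have := zetaExt_quadratic s w
  simp [h] at this

theorem norm_sq_zetaEdge_of_abs_le (s : Edge) {x : ℝ} (h : |x| ≤ 1) : ‖zetaEdge s x‖ ^ 2 = 1 := by
  have h1 : 0 ≤ 1 - x ^ 2 := by
    have := (sq_le_one_iff_abs_le_one x).2 h
    linarith
  rw [zetaEdge_of_abs_le s h, Complex.sq_norm, Complex.normSq_apply]
  have h2 := Real.sq_sqrt h1
  have h3 := s.sign_mul_self
  simp
  linear_combination h2 + Real.sqrt (1 - x ^ 2) ^ 2 * h3

theorem norm_zetaEdge_of_abs_le (s : Edge) {x : ℝ} (h : |x| ≤ 1) : ‖zetaEdge s x‖ = 1 := by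
  have := norm_sq_zetaEdge_of_abs_le s h
  have h0 := norm_nonneg (zetaEdge s x)
  nlinarith

theorem norm_zetaExt_le_one (s : Edge) (w : ℂ) : ‖zetaExt s w‖ ≤ 1 := by
  unfold zetaExt
  split_ifs
  · by_cases h : |w.re| ≤ 1
    · exact (norm_zetaEdge_of_abs_le s h).le
    · simp only [zetaEdge, h, if_false]
      exact norm_zeta_le_one _
  · exact norm_zeta_le_one _

/-- For real x, `im_root_mul` leaves Im ζ = 0 or |ζ| = 1. In the second case ζ⁻¹ = conj ζ, hence Re
ζ = x, which is impossible when |ζ| ≤ 1 < |x|. -/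
theorem zeta_im_of_abs_gt {x : ℝ} (h : 1 < |x|) : (zeta x).im = 0 := by
  have h1 := im_root_mul (zeta_quadratic x)
  simp only [Complex.ofReal_im, mul_zero, zero_mul, mul_eq_zero] at h1
  rcases h1 with h1 | h1
  · exact h1
  · exfalso
    have hq := zeta_quadratic x
    have hc : zeta x * conj (zeta x) = 1 := by
      rw [Complex.mul_conj', ← Complex.ofReal_pow, sub_eq_zero.1 h1, Complex.ofReal_one]
    have hne : zeta x ≠ 0 := by
      intro h0; simp [h0] at hc
    have h2 : zeta x + conj (zeta x) = 2 * x := by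
      apply mul_left_cancel₀ hne
      linear_combination hq + hc
    have h3 : 2 * (zeta x).re = 2 * x := by
      have := congrArg Complex.re h2
      simp at this
      linarith
    have h4 := Complex.abs_re_le_norm (zeta x)
    have h5 := norm_zeta_le_one x
    have h6 : (zeta x).re = x := by linarith
    rw [h6] at h4
    linarith

theorem zetaExt_im_sign {s : Edge} {w : ℂ} (hw : w ∈ s.closedHalfPlane) :
    s.sign * (zetaExt s w).im ≤ 0 := by
  by_cases h : w.im = 0
  · simp only [zetaExt, h, if_true]
    by_cases hx : |w.re| ≤ 1
    · rw [zetaEdge_of_abs_le s hx]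
      have h3 := s.sign_mul_self
      have := Real.sqrt_nonneg (1 - w.re ^ 2)
      simp
      rw [← mul_assoc, h3]
      linarith
    · simp only [zetaEdge, hx, if_false]
      rw [zeta_im_of_abs_gt (not_le.1 hx)]
      simp
  · have h1 := im_root_mul (zetaExt_quadratic s w)
    have h2 : ‖zetaExt s w‖ < 1 := by
      rw [zetaExt_of_im_ne_zero s h]; exact norm_zeta_lt_one h
    have h3 : ‖zetaExt s w‖ ^ 2 < 1 := by
      have := norm_nonneg (zetaExt s w)
      nlinarith
    have hw' : 0 ≤ s.sign * w.im := hw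
    have h4 : s.sign * (zetaExt s w).im * (‖zetaExt s w‖ ^ 2 - 1) =
        2 * (s.sign * w.im) * ‖zetaExt s w‖ ^ 2 := by
      linear_combination s.sign * h1
    by_contra hc
    push Not at hc
    have h5 : 0 ≤ 2 * (s.sign * w.im) * ‖zetaExt s w‖ ^ 2 := by positivity
    nlinarith

/-- Compares the two factors in `root_sub_mul`: for points of the closed unit disc on the same side
of the real axis the right-hand side is nonnegative, so |x - y| ≤ |1 - xy|. -/
theorem norm_one_sub_mul_sq (x y : ℂ) : ‖1 - x * y‖ ^ 2 - ‖x - y‖ ^ 2 =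
    (1 - ‖x‖ ^ 2) * (1 - ‖y‖ ^ 2) + 4 * (x.im * y.im) := by
  simp only [Complex.sq_norm, Complex.normSq_apply, Complex.sub_re, Complex.sub_im,
    Complex.mul_re, Complex.mul_im, Complex.one_re, Complex.one_im]
  ring

/-- The difference of 2w = x + 1/x and 2w' = y + 1/y, with denominators cleared. It gives Hölder
continuity of ζ in general, and a Lipschitz bound where 1 - xy is bounded away from 0. -/
theorem root_sub_mul {w w' x y : ℂ} (hx : x ^ 2 + 1 = 2 * w * x) (hy : y ^ 2 + 1 = 2 * w' * y) :
    (x - y) * (1 - x * y) = 2 * (w' - w) * (x * y) := by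
  linear_combination x * hy - y * hx

/-- `ζ` is Hölder continuous of order `1/2` on the closed half-plane. -/
theorem norm_zetaExt_sub_sq_le {s : Edge} {w w' : ℂ} (hw : w ∈ s.closedHalfPlane)
    (hw' : w' ∈ s.closedHalfPlane) : ‖zetaExt s w - zetaExt s w'‖ ^ 2 ≤ 2 * ‖w - w'‖ := by
  set x := zetaExt s w
  set y := zetaExt s w'
  have hx1 : ‖x‖ ≤ 1 := norm_zetaExt_le_one s w
  have hy1 : ‖y‖ ≤ 1 := norm_zetaExt_le_one s w'
  have h0 : 0 ≤ x.im * y.im := by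
    have h1 := mul_nonneg_of_nonpos_of_nonpos (zetaExt_im_sign hw) (zetaExt_im_sign hw')
    have h2 := s.sign_mul_self
    have h3 : s.sign * (zetaExt s w).im * (s.sign * (zetaExt s w').im) = x.im * y.im := by
      linear_combination (zetaExt s w).im * (zetaExt s w').im * h2
    linarith
  have h1 := norm_one_sub_mul_sq x y
  have h2 : 0 ≤ (1 - ‖x‖ ^ 2) * (1 - ‖y‖ ^ 2) := by
    apply mul_nonneg
    · nlinarith [norm_nonneg x]
    · nlinarith [norm_nonneg y]
  -- This bounds |x - y|² by |x - y||1 - xy|, which `root_sub_mul` evaluates.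
  have h3 : ‖x - y‖ ≤ ‖1 - x * y‖ := by
    apply le_of_sq_le_sq _ (norm_nonneg _)
    linarith
  have h4 := congrArg norm (root_sub_mul (zetaExt_quadratic s w) (zetaExt_quadratic s w'))
  rw [norm_mul, norm_mul, norm_mul, norm_mul, norm_sub_rev w' w] at h4
  change ‖x - y‖ * ‖1 - x * y‖ = ‖(2 : ℂ)‖ * ‖w - w'‖ * (‖x‖ * ‖y‖) at h4
  have h5 : ‖x‖ * ‖y‖ ≤ 1 := mul_le_one₀ hx1 (norm_nonneg _) hy1
  have h6 : ‖(2 : ℂ)‖ = 2 := by simp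
  rw [h6] at h4
  calc ‖x - y‖ ^ 2 ≤ ‖x - y‖ * ‖1 - x * y‖ := by
        rw [sq]; gcongr
    _ = 2 * ‖w - w'‖ * (‖x‖ * ‖y‖) := h4
    _ ≤ 2 * ‖w - w'‖ * 1 := by gcongr
    _ = _ := mul_one _

theorem continuousOn_zetaExt (s : Edge) : ContinuousOn (zetaExt s) s.closedHalfPlane := by
  intro w hw
  rw [ContinuousWithinAt, tendsto_iff_norm_sub_tendsto_zero]
  have h1 : Tendsto (fun w' => Real.sqrt (2 * ‖w' - w‖)) (𝓝[s.closedHalfPlane] w) (𝓝 0) := by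
    have : Continuous fun w' : ℂ => Real.sqrt (2 * ‖w' - w‖) := by fun_prop
    have := (this.tendsto w).mono_left (nhdsWithin_le_nhds (s := s.closedHalfPlane))
    simpa using this
  refine squeeze_zero' (Eventually.of_forall fun _ => norm_nonneg _) ?_ h1
  filter_upwards [self_mem_nhdsWithin] with w' hw'
  exact Real.le_sqrt_of_sq_le (norm_zetaExt_sub_sq_le hw' hw)

theorem zetaExt_sq_ne_one {s : Edge} {w : ℂ} (h1 : w ≠ 1) (h2 : w ≠ -1) : zetaExt s w ^ 2 ≠ 1 := by
  intro h
  have hq := zetaExt_quadratic s w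
  rcases mul_eq_zero.1 (show (zetaExt s w - 1) * (zetaExt s w + 1) = 0 by linear_combination h)
    with h' | h'
  · apply h1
    rw [sub_eq_zero.1 h'] at hq
    linear_combination -hq / 2
  · apply h2
    rw [eq_neg_of_add_eq_zero_left h'] at hq
    linear_combination hq / 2

/-! ### Backward recursions with a prescribed limit -/

section BackwardRecursion

variable {α E : Type*} [NormedAddCommGroup E]

/-- `N` steps of the backward recursion `x_n = M_n x_{n+1}`, started from `p` at `n + N`. -/
def backwardIterate (M : ℕ → E → E) (p : E) : ℕ → ℕ → E
  | 0, _ => p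
  | N + 1, n => M n (backwardIterate M p N (n + 1))

/-- Both iterates apply the same N maps, one to M_{n+N} p and the other to p. The Lipschitz
constants multiply to at most the exponential of the sum of the ε's. -/
theorem norm_backwardIterate_sub_le {M : ℕ → E → E} {p : E} {ε : ℕ → ℝ}
    (hM : ∀ n x y, ‖M n x - M n y‖ ≤ (1 + ε n) * ‖x - y‖) (hp : ∀ n, ‖M n p - p‖ ≤ ε n)
    (N n : ℕ) : ‖backwardIterate M p (N + 1) n - backwardIterate M p N n‖ ≤
      Real.exp (∑ k ∈ Finset.range N, ε (n + k)) * ε (n + N) := by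
  have hε : ∀ n, 0 ≤ ε n := fun n => (norm_nonneg _).trans (hp n)
  induction N generalizing n with
  | zero => simpa [backwardIterate] using hp n
  | succ N ih =>
    have h1 := hM n (backwardIterate M p (N + 1) (n + 1)) (backwardIterate M p N (n + 1))
    have h2 := ih (n + 1)
    have h3 : 1 + ε n ≤ Real.exp (ε n) := by linarith [Real.add_one_le_exp (ε n)]
    have h4 : ∑ k ∈ Finset.range (N + 1), ε (n + k) =
        ε n + ∑ k ∈ Finset.range N, ε (n + 1 + k) := by
      rw [Finset.sum_range_succ', add_comm]
      simp [add_comm, add_left_comm]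
    rw [h4, Real.exp_add, mul_assoc]
    have h5 : n + (N + 1) = n + 1 + N := by ring
    rw [h5]
    exact h1.trans (mul_le_mul h3 h2 (norm_nonneg _) (Real.exp_pos _).le)

variable [CompleteSpace E]

/-- A backward recursion by maps that are summably close to contractions fixing `p` has a solution
tending to `p`, which depends continuously on parameters. -/
theorem exists_backward_solution [TopologicalSpace α] (S : Set α) (M : α → ℕ → E → E) (p : E)
    {ε : ℕ → ℝ} (hε : Summable ε)
    (hM : ∀ z ∈ S, ∀ n x y, ‖M z n x - M z n y‖ ≤ (1 + ε n) * ‖x - y‖)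
    (hp : ∀ z ∈ S, ∀ n, ‖M z n p - p‖ ≤ ε n)
    (hc : ∀ n (x : α → E), ContinuousOn x S → ContinuousOn (fun z => M z n (x z)) S) :
    ∃ X : α → ℕ → E, (∀ z ∈ S, ∀ n, X z n = M z n (X z (n + 1))) ∧
      (∀ z ∈ S, Tendsto (X z) atTop (𝓝 p)) ∧ ∀ n, ContinuousOn (fun z => X z n) S := by
  rcases S.eq_empty_or_nonempty with rfl | ⟨z₀, hz₀⟩
  · exact ⟨fun _ _ => p, by simp, by simp, by simp⟩
  have hε0 : ∀ n, 0 ≤ ε n := fun n => (norm_nonneg _).trans (hp z₀ hz₀ n)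
  set C := Real.exp (∑' k, ε k) with hC
  -- The constant C does not depend on n, N or z. Hence the telescoping series converges uniformly
  -- on S, and its sum is at most C times a tail of Σ ε, which tends to 0 as n → ∞.
  have hbound : ∀ n, ∀ N, ∀ z ∈ S,
      ‖backwardIterate (M z) p (N + 1) n - backwardIterate (M z) p N n‖ ≤ C * ε (N + n) := by
    intro n N z hz
    refine (norm_backwardIterate_sub_le (hM z hz) (hp z hz) N n).trans ?_
    rw [add_comm N n]
    refine mul_le_mul_of_nonneg_right (Real.exp_le_exp.2 ?_) (hε0 _)
    calc ∑ k ∈ Finset.range N, ε (n + k) ≤ ∑' k, ε (n + k) := by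
          refine Summable.sum_le_tsum _ (fun k _ => hε0 _) ?_
          simpa [add_comm] using (summable_nat_add_iff n).2 hε
      _ = ∑' k, ε (k + n) := by simp [add_comm]
      _ ≤ ∑' k, ε k := by
          rw [← hε.sum_add_tsum_nat_add n]
          have := Finset.sum_nonneg (s := Finset.range n) (fun k _ => hε0 k)
          linarith
  have hsum : ∀ n, Summable fun N => C * ε (N + n) := fun n =>
    ((summable_nat_add_iff n).2 hε).mul_left C
  have hsummable : ∀ n, ∀ z ∈ S, Summable fun N =>
      backwardIterate (M z) p (N + 1) n - backwardIterate (M z) p N n := fun n z hz =>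
    Summable.of_norm_bounded (hsum n) fun N => hbound n N z hz
  have hlim : ∀ n, ∀ z ∈ S, Tendsto (fun N => backwardIterate (M z) p N n) atTop
      (𝓝 (p + ∑' N, (backwardIterate (M z) p (N + 1) n - backwardIterate (M z) p N n))) := by
    intro n z hz
    have h := (hsummable n z hz).hasSum.tendsto_sum_nat.const_add p
    refine h.congr fun N => ?_
    rw [Finset.sum_range_sub (fun N => backwardIterate (M z) p N n)]
    simp [backwardIterate]
  refine ⟨fun z n => p + ∑' N, (backwardIterate (M z) p (N + 1) n - backwardIterate (M z) p N n),
    fun z hz n => ?_, fun z hz => ?_, fun n => ?_⟩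
  · have h1 := (tendsto_add_atTop_iff_nat 1).2 (hlim n z hz)
    refine tendsto_nhds_unique h1 ?_
    have h2 := hlim (n + 1) z hz
    have hcont : Continuous (M z n) := by
      refine LipschitzWith.continuous (K := (1 + ε n).toNNReal) (.of_dist_le_mul fun x y => ?_)
      rw [dist_eq_norm, dist_eq_norm, Real.coe_toNNReal _ (by linarith [hε0 n])]
      exact hM z hz n x y
    exact (hcont.tendsto _).comp h2
  · rw [tendsto_iff_norm_sub_tendsto_zero]
    have h0 := (tendsto_sum_nat_add ε).const_mul C
    rw [mul_zero] at h0
    refine squeeze_zero (fun _ => norm_nonneg _) (fun n => ?_) h0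
    rw [add_sub_cancel_left, ← tsum_mul_left]
    exact tsum_of_norm_bounded (hsum n).hasSum fun N => hbound n N z hz
  · refine continuousOn_const.add (continuousOn_tsum (fun N => ?_) (hsum n) (hbound n))
    have : ∀ N n, ContinuousOn (fun z => backwardIterate (M z) p N n) S := by
      intro N
      induction N with
      | zero => exact fun n => continuousOn_const
      | succ N ih => exact fun n => hc n _ (ih (n + 1))
    exact (this _ _).sub (this _ _)

end BackwardRecursion

/-! ### The domain of the spectral parameter -/

/-- The closed half-plane adjacent to an edge, without the real points outside `(-1, 1)`. -/
def Edge.domain (s : Edge) : Set ℂ := {z : ℂ | 0 ≤ s.sign * z.im ∧ (z.im = 0 → |z.re| < 1)}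

theorem Edge.domain_subset (s : Edge) : s.domain ⊆ s.closedHalfPlane := fun _ h => h.1

theorem Edge.sign_ne_zero (s : Edge) : s.sign ≠ 0 := by
  cases s <;> simp [Edge.sign]

theorem Edge.ofReal_mem_domain (s : Edge) {x : ℝ} (hx : x ∈ Ioo (-1 : ℝ) 1) :
    (x : ℂ) ∈ s.domain := by
  refine ⟨by simp, fun _ => ?_⟩
  simpa [abs_lt] using hx

theorem Edge.im_ne_zero {s : Edge} {z : ℂ} (hz : z ∈ s.halfPlane) : z.im ≠ 0 := by
  intro h
  have : 0 < s.sign * z.im := hz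
  simp [h] at this

theorem Edge.halfPlane_subset_domain (s : Edge) : s.halfPlane ⊆ s.domain := fun _ h =>
  ⟨le_of_lt h, fun h0 => absurd h0 (Edge.im_ne_zero h)⟩

theorem zetaExt_sq_ne_one_of_mem {s : Edge} {z : ℂ} (hz : z ∈ s.domain) : zetaExt s z ^ 2 ≠ 1 := by
  refine zetaExt_sq_ne_one ?_ ?_
  · rintro rfl
    have := hz.2 (by simp)
    simp at this
  · rintro rfl
    have := hz.2 (by simp)
    simp at this

/-! ### Variation of constants -/

/-- One step of the backward recursion for the amplitudes of a solution along the two approximate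
exponentials. -/
noncomputable def jostStep (ρ ζ η : ℂ) (X : ℂ × ℂ) : ℂ × ℂ :=
  (((ρ / η - ζ) * X.1 + (ρ * η - ζ) * X.2) * ζ / (1 - ζ ^ 2),
    ((1 - ρ * ζ / η) * X.1 + (1 - ρ * ζ * η) * X.2) * ζ ^ 2 / (1 - ζ ^ 2))

section JostStep

variable {ρ ζ η : ℂ}

theorem jostStep_sub (X Y : ℂ × ℂ) :
    jostStep ρ ζ η X - jostStep ρ ζ η Y = jostStep ρ ζ η (X - Y) := by
  ext <;> simp only [jostStep, Prod.fst_sub, Prod.snd_sub] <;> ring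

/-- Displays the step as a perturbation of (x, y) ↦ (x, ζ²y); both error coefficients vanish when ρ
= 1 and η = ζ. -/
theorem jostStep_eq (hη : η ≠ 0) (hζ : 1 - ζ ^ 2 ≠ 0) (X : ℂ × ℂ) :
    jostStep ρ ζ η X =
      (X.1 + (ρ * ζ - η) / (η * (1 - ζ ^ 2)) * X.1 + (ρ * η - ζ) / (1 - ζ ^ 2) * ζ * X.2,
      ζ ^ 2 * X.2 - (ρ * ζ - η) / (η * (1 - ζ ^ 2)) * ζ ^ 2 * X.1 -
        (ρ * η - ζ) / (1 - ζ ^ 2) * ζ ^ 3 * X.2) := by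
  ext
  · simp only [jostStep]
    field_simp
    ring
  · simp only [jostStep]
    field_simp
    ring

/-- With ζ = ζ_n, η = ζ_{n+1} and ρ = a_{n+1}/a_n, this is the Jacobi equation solved for f_n =
q_n(x_n + y_n) in terms of the amplitudes at n + 1. -/
theorem jostStep_fst_add_snd (hη : η ≠ 0) (hζ : 1 - ζ ^ 2 ≠ 0) (X : ℂ × ℂ) :
    (jostStep ρ ζ η X).1 + (jostStep ρ ζ η X).2 = ρ * ζ * (X.1 / η + η * X.2) := by
  simp only [jostStep]
  field_simp
  ring

/-- Both sides are ζ_n f_{n+1}/q_n, computed on the left from the amplitudes at n and on the right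
from those at n + 1. -/
theorem jostStep_sq_fst_add_snd (hη : η ≠ 0) (hζ : 1 - ζ ^ 2 ≠ 0) (X : ℂ × ℂ) :
    ζ ^ 2 * (jostStep ρ ζ η X).1 + (jostStep ρ ζ η X).2 = ζ ^ 2 * (X.1 + X.2) := by
  simp only [jostStep]
  field_simp
  ring

variable {κ δ : ℝ}

theorem norm_jostStep_coeff_le (hδ : 0 < δ) (hδ1 : δ ≤ 1) (hζ1 : ‖ζ‖ ≤ 1) (hη1 : ‖η‖ ≤ 1)
    (hη : δ ≤ ‖η‖) (hζ : δ ≤ ‖1 - ζ ^ 2‖) (hρ : ‖ρ - 1‖ ≤ κ) (hd : ‖η - ζ‖ ≤ κ) :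
    ‖(ρ * ζ - η) / (η * (1 - ζ ^ 2))‖ ≤ 2 * κ / δ ^ 2 ∧
      ‖(ρ * η - ζ) / (1 - ζ ^ 2)‖ ≤ 2 * κ / δ ^ 2 := by
  have hκ : 0 ≤ κ := (norm_nonneg _).trans hρ
  have h1 : ‖ρ * ζ - η‖ ≤ 2 * κ := by
    have : ρ * ζ - η = (ρ - 1) * ζ - (η - ζ) := by ring
    rw [this]
    refine (norm_sub_le _ _).trans ?_
    rw [norm_mul]
    have := mul_le_mul hρ hζ1 (norm_nonneg _) hκ
    linarith
  have h2 : ‖ρ * η - ζ‖ ≤ 2 * κ := by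
    have : ρ * η - ζ = (ρ - 1) * η + (η - ζ) := by ring
    rw [this]
    refine (norm_add_le _ _).trans ?_
    rw [norm_mul]
    have := mul_le_mul hρ hη1 (norm_nonneg _) hκ
    linarith
  constructor
  · rw [norm_div, norm_mul]
    refine div_le_div₀ (by positivity) h1 (by positivity) ?_
    rw [sq]
    exact mul_le_mul hη hζ hδ.le (norm_nonneg _)
  · rw [norm_div]
    refine div_le_div₀ (by positivity) h2 (by positivity) ?_
    nlinarith

/-- In the maximum norm the unperturbed map is a contraction because |ζ| ≤ 1. Each component has at
most two error terms, each bounded by τ‖X‖, whence the factor 2 between τ and the final constant. -/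
theorem norm_jostStep_le (hδ : 0 < δ) (hδ1 : δ ≤ 1) (hζ1 : ‖ζ‖ ≤ 1) (hη1 : ‖η‖ ≤ 1)
    (hη : δ ≤ ‖η‖) (hζ : δ ≤ ‖1 - ζ ^ 2‖) (hρ : ‖ρ - 1‖ ≤ κ) (hd : ‖η - ζ‖ ≤ κ) (X : ℂ × ℂ) :
    ‖jostStep ρ ζ η X‖ ≤ (1 + 4 * κ / δ ^ 2) * ‖X‖ ∧
      ‖jostStep ρ ζ η (1, 0) - (1, 0)‖ ≤ 4 * κ / δ ^ 2 := by
  have hη0 : η ≠ 0 := norm_pos_iff.1 (hδ.trans_le hη)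
  have hζ0 : 1 - ζ ^ 2 ≠ 0 := norm_pos_iff.1 (hδ.trans_le hζ)
  obtain ⟨hA, hB⟩ := norm_jostStep_coeff_le hδ hδ1 hζ1 hη1 hη hζ hρ hd
  have hτ : 4 * κ / δ ^ 2 = 2 * (2 * κ / δ ^ 2) := by ring
  rw [hτ]
  set τ := 2 * κ / δ ^ 2
  set A := (ρ * ζ - η) / (η * (1 - ζ ^ 2))
  set B := (ρ * η - ζ) / (1 - ζ ^ 2)
  have hτ0 : 0 ≤ τ := (norm_nonneg _).trans hA
  have hz2 : ‖ζ ^ 2‖ ≤ 1 := by rw [norm_pow]; exact pow_le_one₀ (norm_nonneg _) hζ1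
  have hz3 : ‖ζ ^ 3‖ ≤ 1 := by rw [norm_pow]; exact pow_le_one₀ (norm_nonneg _) hζ1
  have hmul : ∀ u v w : ℂ, ∀ r : ℝ, ‖u‖ ≤ τ → ‖v‖ ≤ 1 → ‖w‖ ≤ r → ‖u * v * w‖ ≤ τ * r := by
    intro u v w r hu hv hw
    rw [norm_mul, norm_mul]
    have h1 : ‖u‖ * ‖v‖ ≤ τ * 1 := mul_le_mul hu hv (norm_nonneg _) hτ0
    rw [mul_one] at h1
    exact mul_le_mul h1 hw (norm_nonneg _) hτ0
  constructor
  · rw [jostStep_eq hη0 hζ0]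
    have hX1 := norm_fst_le X
    have hX2 := norm_snd_le X
    refine norm_prod_le_iff.2 ⟨?_, ?_⟩
    · have h1 := hmul A 1 X.1 _ hA (by simp) hX1
      rw [mul_one] at h1
      have h2 := hmul B ζ X.2 _ hB hζ1 hX2
      refine (norm_add₃_le).trans ?_
      linarith
    · have h0 : ‖ζ ^ 2 * X.2‖ ≤ ‖X‖ := by
        rw [norm_mul]
        exact (mul_le_of_le_one_left (norm_nonneg _) hz2).trans hX2
      have h1 := hmul A (ζ ^ 2) X.1 _ hA hz2 hX1
      have h2 := hmul B (ζ ^ 3) X.2 _ hB hz3 hX2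
      refine (norm_sub_le _ _).trans ?_
      have h3 := norm_sub_le (ζ ^ 2 * X.2) (A * ζ ^ 2 * X.1)
      linarith
  · rw [jostStep_eq hη0 hζ0]
    refine norm_prod_le_iff.2 ⟨?_, ?_⟩
    · simp only [Prod.fst_sub, mul_one, mul_zero, add_zero]
      change ‖1 + A - 1‖ ≤ _
      rw [add_sub_cancel_left]
      linarith
    · simp only [Prod.snd_sub, mul_one, mul_zero, sub_zero]
      change ‖0 - A * ζ ^ 2‖ ≤ _
      rw [zero_sub, norm_neg]
      have h1 := hmul A (ζ ^ 2) 1 1 hA hz2 (by simp)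
      rw [mul_one] at h1
      linarith

end JostStep

/-! ### The sequences ζ_n and q_n on a closed half-plane -/

namespace Coeffs

variable (c : Coeffs)

theorem aPrev_pos (n : ℕ) : 0 < c.aPrev n := by
  cases n with
  | zero => norm_num [aPrev]
  | succ n => exact c.a_pos n

theorem aPrev_ne_zero (n : ℕ) : (c.aPrev n : ℂ) ≠ 0 := by
  exact_mod_cast (c.aPrev_pos n).ne'

theorem a_ne_zero (n : ℕ) : (c.a n : ℂ) ≠ 0 := by
  exact_mod_cast (c.a_pos n).ne'

/-- `ζ_n(z)` on a closed half-plane. -/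
noncomputable def zetaSeqExt (s : Edge) (z : ℂ) (n : ℕ) : ℂ := zetaExt s ((z - c.b n) / (2 * c.a n))

theorem scaled_im (z : ℂ) (n : ℕ) : ((z - c.b n) / (2 * c.a n)).im = (2 * c.a n)⁻¹ * z.im := by
  have : (z - c.b n) / (2 * c.a n) = (((2 * c.a n)⁻¹ : ℝ) : ℂ) * (z - c.b n) := by
    push_cast
    rw [div_eq_inv_mul]
  rw [this, Complex.im_ofReal_mul]
  simp

theorem zetaSeqExt_of_im_ne_zero (s : Edge) {z : ℂ} (hz : z.im ≠ 0) :
    c.zetaSeqExt s z = c.zetaSeq z := by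
  funext n
  refine zetaExt_of_im_ne_zero s ?_
  rw [scaled_im]
  have := c.a_pos n
  positivity

theorem zetaSeqExt_ofReal (s : Edge) (x : ℝ) : c.zetaSeqExt s x = c.zetaSeqEdge s x := by
  funext n
  rw [zetaSeqEdge, ← zetaExt_ofReal]
  push_cast
  rfl

theorem scaled_mem {s : Edge} {z : ℂ} (hz : z ∈ s.closedHalfPlane) (n : ℕ) :
    (z - c.b n) / (2 * c.a n) ∈ s.closedHalfPlane := by
  have h := c.a_pos n
  have hz' : 0 ≤ s.sign * z.im := hz
  change 0 ≤ s.sign * _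
  rw [scaled_im, mul_left_comm]
  positivity

theorem zetaSeqExt_ne_zero (s : Edge) (z : ℂ) (n : ℕ) : c.zetaSeqExt s z n ≠ 0 :=
  zetaExt_ne_zero _ _

theorem norm_zetaSeqExt_le_one (s : Edge) (z : ℂ) (n : ℕ) : ‖c.zetaSeqExt s z n‖ ≤ 1 :=
  norm_zetaExt_le_one _ _

theorem zetaSeqExt_quadratic (s : Edge) (z : ℂ) (n : ℕ) :
    c.a n * (c.zetaSeqExt s z n ^ 2 + 1) = (z - c.b n) * c.zetaSeqExt s z n := by
  have h := zetaExt_quadratic s ((z - c.b n) / (2 * c.a n))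
  have ha := c.a_ne_zero n
  unfold zetaSeqExt
  rw [h]
  field_simp

theorem continuousOn_zetaSeqExt (s : Edge) (n : ℕ) :
    ContinuousOn (fun z => c.zetaSeqExt s z n) s.closedHalfPlane :=
  (continuousOn_zetaExt s).comp (by fun_prop) fun _ hz => c.scaled_mem hz n

/-- `q_n(z)` on a closed half-plane. -/
noncomputable def qExt (s : Edge) (z : ℂ) (n : ℕ) : ℂ := ∏ m ∈ Finset.range n, c.zetaSeqExt s z m

theorem qExt_ne_zero (s : Edge) (z : ℂ) (n : ℕ) : c.qExt s z n ≠ 0 :=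
  Finset.prod_ne_zero_iff.2 fun _ _ => c.zetaSeqExt_ne_zero _ _ _

theorem qExt_succ (s : Edge) (z : ℂ) (n : ℕ) :
    c.qExt s z (n + 1) = c.qExt s z n * c.zetaSeqExt s z n := Finset.prod_range_succ _ _

theorem continuousOn_qExt (s : Edge) (n : ℕ) :
    ContinuousOn (fun z => c.qExt s z n) s.closedHalfPlane :=
  continuousOn_finsetProd _ fun m _ => c.continuousOn_zetaSeqExt s m

/-! ### Uniqueness of the Jost solution -/

variable {c} in
-- Since a_{n-1} ≠ 0, the equation determines g_{n-1} from g_n and g_{n+1}, so agreement near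
-- infinity descends to n = -1.
theorem IsSolution.eq_of_eventually_eq {z : ℂ} {f g : ℕ → ℂ} (hf : c.IsSolution z f)
    (hg : c.IsSolution z g) {N : ℕ} (h : ∀ n, N ≤ n → f n = g n) : f = g := by
  induction N with
  | zero => exact funext fun n => h n n.zero_le
  | succ N ih =>
    refine ih fun n hn => ?_
    rcases hn.eq_or_lt with rfl | hn
    · have h1 := hf N
      have h2 := hg N
      rw [h (N + 1) le_rfl, h (N + 2) (by omega)] at h1
      exact mul_left_cancel₀ (c.aPrev_ne_zero N) (by linear_combination h1 - h2)
    · exact h n hn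

theorem norm_prod_range_le_one {ζ : ℕ → ℂ} (hζ : ∀ n, ‖ζ n‖ ≤ 1) (n : ℕ) :
    ‖∏ m ∈ Finset.range n, ζ m‖ ≤ 1 := by
  rw [norm_prod]
  exact Finset.prod_le_one (fun _ _ => norm_nonneg _) fun m _ => hζ m

variable {c} in
-- The constant Wronskian equals a_n q_n q_{n+1} times a factor tending to 1 · 1 - 1 · 1 = 0, and
-- the prefactor is bounded because all |ζ_m| ≤ 1.
theorem IsJostSolution.wronskian_eq_zero {ζ : ℕ → ℂ} {z : ℂ} {f g : ℕ → ℂ}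
    (hζ0 : ∀ n, ζ n ≠ 0) (hζ : ∀ n, ‖ζ n‖ ≤ 1) (hf : c.IsJostSolution ζ z f)
    (hg : c.IsJostSolution ζ z g) : c.wronskianAt f g 0 = 0 := by
  set q : ℕ → ℂ := fun n => ∏ m ∈ Finset.range n, ζ m with hq
  have hq0 : ∀ n, q n ≠ 0 := fun n => Finset.prod_ne_zero_iff.2 fun m _ => hζ0 m
  obtain ⟨C, hC⟩ := c.bounded
  have hlim := ((hf.2.mul ((tendsto_add_atTop_iff_nat 1).2 hg.2)).sub
    (((tendsto_add_atTop_iff_nat 1).2 hf.2).mul hg.2))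
  rw [sub_self] at hlim
  have hbdd : IsBoundedUnder (· ≤ ·) atTop
      (norm ∘ fun n : ℕ => (c.a n : ℂ) * (q n * q (n + 1))) := by
    refine isBoundedUnder_of ⟨C, fun n => ?_⟩
    have h1 := (hC n).1
    have h2 : ‖q n‖ ≤ 1 := norm_prod_range_le_one hζ n
    have h3 : ‖q (n + 1)‖ ≤ 1 := norm_prod_range_le_one hζ _
    simp only [Function.comp, norm_mul, Complex.norm_real, Real.norm_eq_abs]
    exact (mul_le_of_le_one_right (abs_nonneg _) (mul_le_one₀ h2 (norm_nonneg _) h3)).trans h1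
  have h0 := hlim.zero_mul_isBoundedUnder_le hbdd
  have hconst : ∀ n : ℕ, c.wronskianAt f g (n + 1) = c.wronskianAt f g 0 := fun n =>
    c.wronskianAt_eq hf.1 hg.1 _
  refine (tendsto_nhds_unique (h0.congr fun n => ?_)
    (tendsto_const_nhds (x := c.wronskianAt f g 0))).symm
  rw [← hconst n]
  have e1 := hq0 n
  have e2 := hq0 (n + 1)
  simp only [wronskianAt, aPrev]
  change (f (n + 1) / q n * (g (n + 1 + 1) / q (n + 1)) -
    f (n + 1 + 1) / q (n + 1) * (g (n + 1) / q n)) * _ = _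
  field_simp

variable {c} in
theorem IsJostSolution.eventually_ne_zero {ζ : ℕ → ℂ} {z : ℂ} {f : ℕ → ℂ}
    (hf : c.IsJostSolution ζ z f) : ∀ᶠ n in atTop, f (n + 1) ≠ 0 := by
  filter_upwards [hf.2.eventually_ne one_ne_zero] with n hn h
  exact hn (by simp [h])

variable {c} in
/-- The Jost solution is unique. -/
theorem IsJostSolution.unique {ζ : ℕ → ℂ} {z : ℂ} {f g : ℕ → ℂ}
    (hζ0 : ∀ n, ζ n ≠ 0) (hζ : ∀ n, ‖ζ n‖ ≤ 1) (hf : c.IsJostSolution ζ z f)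
    (hg : c.IsJostSolution ζ z g) : f = g := by
  have hq0 : ∀ n, ∏ m ∈ Finset.range n, ζ m ≠ 0 :=
    fun n => Finset.prod_ne_zero_iff.2 fun m _ => hζ0 m
  have hW := IsJostSolution.wronskian_eq_zero hζ0 hζ hf hg
  have hprop : ∀ n, f (n + 1) * g (n + 2) = f (n + 2) * g (n + 1) := by
    intro n
    have h := c.wronskianAt_eq hf.1 hg.1 (n + 1)
    rw [hW] at h
    exact sub_eq_zero.1 ((mul_eq_zero.1 h).resolve_left (c.aPrev_ne_zero _))
  obtain ⟨N, hN⟩ := eventually_atTop.1 hf.eventually_ne_zero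
  -- Since the Wronskian vanishes, g/f is constant from the index on where f has no zeros; the
  -- asymptotics identify the constant as 1.
  have hratio : ∀ k, g (N + k + 1) / f (N + k + 1) = g (N + 1) / f (N + 1) := by
    intro k
    induction k with
    | zero => rfl
    | succ k ih =>
      rw [← ih, div_eq_div_iff (hN _ (by omega)) (hN _ (by omega))]
      have := hprop (N + k)
      linear_combination this
  have hlim : Tendsto (fun n => g (n + 1) / f (n + 1)) atTop (𝓝 1) := by
    have := hg.2.div hf.2 one_ne_zero
    rw [div_one] at this
    refine this.congr fun n => ?_
    have := hq0 n
    simp only [Pi.div_apply]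
    rw [div_div_div_cancel_right₀ this]
  have h1 : g (N + 1) / f (N + 1) = 1 := by
    have h := (tendsto_add_atTop_iff_nat N).2 hlim
    simp only [add_comm _ N, hratio] at h
    exact tendsto_nhds_unique tendsto_const_nhds h
  refine hf.1.eq_of_eventually_eq hg.1 (N := N + 1) fun n hn => ?_
  obtain ⟨k, rfl⟩ := Nat.exists_eq_add_of_le hn
  have h2 := hratio k
  rw [h1, div_eq_one_iff_eq (hN _ (by omega))] at h2
  rw [show N + 1 + k = N + k + 1 by ring]
  exact h2.symm

/-- Solutions near infinity extend to all indices. -/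
theorem exists_isSolution_extension (S : Set ℂ) (N : ℕ) (g : ℂ → ℕ → ℂ)
    (hg : ∀ z ∈ S, ∀ n, N ≤ n →
      c.aPrev n * g z n + c.b n * g z (n + 1) + c.a n * g z (n + 2) = z * g z (n + 1))
    (hc : ∀ n, N ≤ n → ContinuousOn (fun z => g z n) S) :
    ∃ G : ℂ → ℕ → ℂ, (∀ z ∈ S, c.IsSolution z (G z)) ∧ (∀ z n, N ≤ n → G z n = g z n) ∧
      ∀ n, ContinuousOn (fun z => G z n) S := by
  induction N generalizing g with
  | zero => exact ⟨g, fun z hz n => hg z hz n n.zero_le, fun _ _ _ => rfl, fun n => hc n n.zero_le⟩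
  | succ N ih =>
    -- The equation at n = N, solved for its first term.
    set g' : ℂ → ℕ → ℂ := fun z => Function.update (g z) N
      ((z * g z (N + 1) - c.b N * g z (N + 1) - c.a N * g z (N + 2)) / c.aPrev N) with hg'
    have hne : ∀ z n, N < n → g' z n = g z n := fun z n hn => by
      simp [hg', Function.update_of_ne hn.ne']
    have hN : ∀ z, g' z N =
        (z * g z (N + 1) - c.b N * g z (N + 1) - c.a N * g z (N + 2)) / c.aPrev N := fun z => by
      simp [hg']
    have hg'sol : ∀ z ∈ S, ∀ n, N ≤ n →
        c.aPrev n * g' z n + c.b n * g' z (n + 1) + c.a n * g' z (n + 2) = z * g' z (n + 1) := by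
      intro z hz n hn
      rw [hne z (n + 1) (by omega), hne z (n + 2) (by omega)]
      rcases hn.eq_or_lt with rfl | hn
      · rw [hN, mul_div_cancel₀ _ (c.aPrev_ne_zero N)]
        ring
      · rw [hne z n hn]
        exact hg z hz n hn
    have hg'cont : ∀ n, N ≤ n → ContinuousOn (fun z => g' z n) S := by
      intro n hn
      rcases hn.eq_or_lt with rfl | hn
      · simp only [hN]
        have h1 := hc (N + 1) le_rfl
        have h2 := hc (N + 2) (by omega)
        fun_prop
      · simp only [hne _ _ hn]
        exact hc n hn
    obtain ⟨G, h1, h2, h3⟩ := ih g' hg'sol hg'cont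
    exact ⟨G, h1, fun z n hn => (h2 z n (by omega)).trans (hne z n hn), h3⟩

end Coeffs

namespace Coeffs

variable (c : Coeffs)

/-! ### Existence of the Jost solution -/

/-- The sum of the increments of the coefficients at `n`. -/
noncomputable def increment (n : ℕ) : ℝ := |c.a (n + 1) - c.a n| + |c.b (n + 1) - c.b n|

variable {c}

theorem tendsto_a (ha : Tendsto (fun n => c.a n - 1 / 2) atTop (𝓝 0)) :
    Tendsto c.a atTop (𝓝 (1 / 2)) := by
  have h := ha.add_const (1 / 2)
  simp only [sub_add_cancel, zero_add] at h
  exact h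

theorem tendsto_zetaSeqExt (ha : Tendsto (fun n => c.a n - 1 / 2) atTop (𝓝 0))
    (hb : Tendsto c.b atTop (𝓝 0)) {s : Edge} {z₀ : ℂ} (hz₀ : z₀ ∈ s.domain) :
    Tendsto (fun p : ℂ × ℕ => c.zetaSeqExt s p.1 p.2) (𝓝[s.domain] z₀ ×ˢ atTop)
      (𝓝 (zetaExt s z₀)) := by
  have hcont := continuousOn_zetaExt s z₀ (s.domain_subset hz₀)
  refine hcont.tendsto.comp (tendsto_nhdsWithin_iff.2 ⟨?_, ?_⟩)
  · have h1 : Tendsto (fun p : ℂ × ℕ => p.1) (𝓝[s.domain] z₀ ×ˢ atTop) (𝓝 z₀) :=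
      tendsto_fst.mono_right nhdsWithin_le_nhds
    have h2 : Tendsto (fun p : ℂ × ℕ => (c.b p.2 : ℂ)) (𝓝[s.domain] z₀ ×ˢ atTop) (𝓝 (0 : ℝ)) :=
      ((Complex.continuous_ofReal.tendsto _).comp hb).comp tendsto_snd
    have h3 : Tendsto (fun p : ℂ × ℕ => (c.a p.2 : ℂ)) (𝓝[s.domain] z₀ ×ˢ atTop)
        (𝓝 (1 / 2 : ℝ)) :=
      ((Complex.continuous_ofReal.tendsto _).comp (tendsto_a ha)).comp tendsto_snd
    have h4 := (h1.sub h2).div (h3.const_mul 2) (by simp)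
    simp at h4
    exact h4
  · have h : ∀ᶠ p : ℂ × ℕ in 𝓝[s.domain] z₀ ×ˢ atTop, p.1 ∈ s.domain :=
      tendsto_fst.eventually self_mem_nhdsWithin
    filter_upwards [h] with p hp
    exact c.scaled_mem (s.domain_subset hp) _

theorem zetaSeqExt_sub_mul (s : Edge) (z : ℂ) (n : ℕ) :
    (c.zetaSeqExt s z n - c.zetaSeqExt s z (n + 1)) *
      (1 - c.zetaSeqExt s z n * c.zetaSeqExt s z (n + 1)) =
    ((z - c.b n) * (c.a n - c.a (n + 1)) - (c.b (n + 1) - c.b n) * c.a n) /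
      (c.a n * c.a (n + 1)) * (c.zetaSeqExt s z n * c.zetaSeqExt s z (n + 1)) := by
  have h := root_sub_mul (zetaExt_quadratic s ((z - c.b n) / (2 * c.a n)))
    (zetaExt_quadratic s ((z - c.b (n + 1)) / (2 * c.a (n + 1))))
  have h1 := c.a_ne_zero n
  have h2 := c.a_ne_zero (n + 1)
  refine h.trans ?_
  congr 1
  field_simp
  ring

/-- The lower bound on 1 - ζ_n ζ_{n+1} makes ζ_n vary no faster than the coefficients, so its
increments are summable too. The constants 16 and 4 bound 1/(a_n a_{n+1}) and 1/a_{n+1}. -/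
theorem norm_zetaSeqExt_sub_le {s : Edge} {z : ℂ} {n : ℕ} {R δ : ℝ} (hδ : 0 < δ)
    (hz : ‖z - c.b n‖ ≤ R) (h0 : 1 / 4 ≤ c.a n) (h1 : 1 / 4 ≤ c.a (n + 1))
    (h : δ ≤ ‖1 - c.zetaSeqExt s z n * c.zetaSeqExt s z (n + 1)‖) :
    ‖c.zetaSeqExt s z (n + 1) - c.zetaSeqExt s z n‖ ≤ (16 * R + 4) / δ * c.increment n := by
  have hR : 0 ≤ R := (norm_nonneg _).trans hz
  have hid := congrArg norm (zetaSeqExt_sub_mul (c := c) s z n)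
  set ζ := c.zetaSeqExt s z n
  set η := c.zetaSeqExt s z (n + 1)
  have hζη : ‖ζ * η‖ ≤ 1 := by
    rw [norm_mul]
    exact mul_le_one₀ (c.norm_zetaSeqExt_le_one s z n) (norm_nonneg _)
      (c.norm_zetaSeqExt_le_one s z (n + 1))
  have ha0 := c.a_pos n
  have ha1 := c.a_pos (n + 1)
  set da := |c.a (n + 1) - c.a n| with hda
  set db := |c.b (n + 1) - c.b n| with hdb
  have hquot : ‖((z - c.b n) * (c.a n - c.a (n + 1)) - (c.b (n + 1) - c.b n) * c.a n) /
      (c.a n * c.a (n + 1))‖ ≤ 16 * R * da + 4 * db := by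
    have e : ((z - c.b n) * (c.a n - c.a (n + 1)) - (c.b (n + 1) - c.b n) * c.a n) /
      (c.a n * c.a (n + 1)) = (z - c.b n) * ((c.a n - c.a (n + 1) : ℝ) : ℂ) *
        (((c.a n * c.a (n + 1))⁻¹ : ℝ) : ℂ) -
        ((c.b (n + 1) - c.b n : ℝ) : ℂ) * (((c.a (n + 1))⁻¹ : ℝ) : ℂ) := by
      have e1 := c.a_ne_zero n
      have e2 := c.a_ne_zero (n + 1)
      push_cast
      field_simp
    rw [e]
    refine (norm_sub_le _ _).trans ?_
    simp only [norm_mul, Complex.norm_real, Real.norm_eq_abs]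
    rw [abs_sub_comm (c.a n), ← hda, ← hdb, abs_of_pos (inv_pos.2 (mul_pos ha0 ha1)),
      abs_of_pos (inv_pos.2 ha1)]
    have i1 : (c.a (n + 1))⁻¹ ≤ 4 := by
      rw [inv_le_comm₀ ha1 (by norm_num)]; linarith
    have i2 : (c.a n * c.a (n + 1))⁻¹ ≤ 16 := by
      rw [inv_le_comm₀ (mul_pos ha0 ha1) (by norm_num)]; nlinarith
    have j1 : ‖z - c.b n‖ * da * (c.a n * c.a (n + 1))⁻¹ ≤ R * da * 16 := by gcongr
    have j2 : db * (c.a (n + 1))⁻¹ ≤ db * 4 := by gcongr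
    linarith
  have hda0 : 0 ≤ da := abs_nonneg _
  have hdb0 : 0 ≤ db := abs_nonneg _
  rw [norm_mul, norm_mul] at hid
  rw [div_mul_eq_mul_div, le_div_iff₀ hδ, norm_sub_rev]
  calc ‖ζ - η‖ * δ ≤ ‖ζ - η‖ * ‖1 - ζ * η‖ := by gcongr
    _ = _ := hid
    _ ≤ (16 * R * da + 4 * db) * 1 := by gcongr
    _ ≤ (16 * R + 4) * (da + db) := by nlinarith [mul_nonneg hR hdb0]

theorem norm_ratio_sub_one_le {n : ℕ} (h0 : 1 / 4 ≤ c.a n) :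
    ‖(c.a (n + 1) / c.a n - 1 : ℂ)‖ ≤ 4 * c.increment n := by
  have ha0 := c.a_pos n
  have e : (c.a (n + 1) / c.a n - 1 : ℂ) =
      ((c.a (n + 1) - c.a n : ℝ) : ℂ) * (((c.a n)⁻¹ : ℝ) : ℂ) := by
    have e1 := c.a_ne_zero n
    push_cast
    field_simp
  rw [e, norm_mul, Complex.norm_real, Complex.norm_real, Real.norm_eq_abs, Real.norm_eq_abs,
    abs_of_pos (inv_pos.2 ha0), increment]
  have i1 : (c.a n)⁻¹ ≤ 4 := by
    rw [inv_le_comm₀ ha0 (by norm_num)]; linarith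
  have := abs_nonneg (c.b (n + 1) - c.b n)
  have j : |c.a (n + 1) - c.a n| * (c.a n)⁻¹ ≤ |c.a (n + 1) - c.a n| * 4 := by gcongr
  linarith

/-- Lower bounds near a point of the domain, uniform in the index. -/
theorem exists_uniform_bounds (ha : Tendsto (fun n => c.a n - 1 / 2) atTop (𝓝 0))
    (hb : Tendsto c.b atTop (𝓝 0)) {s : Edge} {z₀ : ℂ} (hz₀ : z₀ ∈ s.domain) :
    ∃ U ∈ 𝓝[s.domain] z₀, U ⊆ s.domain ∧ ∃ N : ℕ, ∃ δ R : ℝ, 0 < δ ∧ δ ≤ 1 ∧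
      ∀ z ∈ U, ∀ n, N ≤ n → ‖z - c.b n‖ ≤ R ∧ 1 / 4 ≤ c.a n ∧ δ ≤ ‖c.zetaSeqExt s z n‖ ∧
        δ ≤ ‖1 - c.zetaSeqExt s z n ^ 2‖ ∧
        δ ≤ ‖1 - c.zetaSeqExt s z n * c.zetaSeqExt s z (n + 1)‖ := by
  have hl := tendsto_zetaSeqExt ha hb hz₀
  have hl' := hl.comp (tendsto_id.prodMap (tendsto_add_atTop_nat 1))
  set ζ := zetaExt s z₀ with hζ
  have hζ0 : 0 < ‖ζ‖ := norm_pos_iff.2 (zetaExt_ne_zero _ _)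
  have hζ1 : 0 < ‖1 - ζ ^ 2‖ := norm_pos_iff.2 (sub_ne_zero.2 (zetaExt_sq_ne_one_of_mem hz₀).symm)
  -- As z → z₀ and n → ∞ jointly, ζ_n(z) and ζ_{n+1}(z) tend to ζ(z₀), so any δ strictly below
  -- |ζ(z₀)| and |1 - ζ(z₀)²| serves all three lower bounds.
  obtain ⟨δ, hδ, hδm⟩ := exists_between (lt_min one_pos (lt_min hζ0 hζ1))
  have hδ0 : δ < ‖ζ‖ := hδm.trans_le ((min_le_right _ _).trans (min_le_left _ _))
  have hδ1 : δ < ‖1 - ζ ^ 2‖ := hδm.trans_le ((min_le_right _ _).trans (min_le_right _ _))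
  have e1 := hl.norm.eventually_const_le hδ0
  have e2 := ((hl.pow 2).const_sub 1).norm.eventually_const_le hδ1
  have e3 := ((hl.mul hl').const_sub 1).norm.eventually_const_le
    (show δ < ‖1 - ζ * ζ‖ by rwa [← sq])
  have e4 : ∀ᶠ p : ℂ × ℕ in 𝓝[s.domain] z₀ ×ˢ atTop, ‖p.1 - c.b p.2‖ ≤ ‖z₀‖ + 1 := by
    have h1 : Tendsto (fun p : ℂ × ℕ => p.1) (𝓝[s.domain] z₀ ×ˢ atTop) (𝓝 z₀) :=
      tendsto_fst.mono_right nhdsWithin_le_nhds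
    have h2 : Tendsto (fun p : ℂ × ℕ => (c.b p.2 : ℂ)) (𝓝[s.domain] z₀ ×ˢ atTop) (𝓝 (0 : ℝ)) :=
      ((Complex.continuous_ofReal.tendsto _).comp hb).comp tendsto_snd
    exact (h1.sub h2).norm.eventually_le_const (by simp)
  have e5 : ∀ᶠ p : ℂ × ℕ in 𝓝[s.domain] z₀ ×ˢ atTop, 1 / 4 ≤ c.a p.2 :=
    tendsto_snd.eventually ((tendsto_a ha).eventually_const_le (by norm_num))
  have e6 : ∀ᶠ p : ℂ × ℕ in 𝓝[s.domain] z₀ ×ˢ atTop, p.1 ∈ s.domain :=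
    tendsto_fst.eventually self_mem_nhdsWithin
  obtain ⟨pa, hpa, pb, hpb, hp⟩ := eventually_prod_iff.1
    (((((e1.and e2).and e3).and e4).and e5).and e6)
  obtain ⟨N, hN⟩ := eventually_atTop.1 hpb
  refine ⟨{z | pa z}, hpa, fun z hz => (hp hz (hN N le_rfl)).2, N, δ, ‖z₀‖ + 1, hδ,
    (hδm.trans_le (min_le_left _ _)).le, fun z hz n hn => ?_⟩
  obtain ⟨⟨⟨⟨⟨h1, h2⟩, h3⟩, h4⟩, h5⟩, -⟩ := hp hz (hN n hn)
  exact ⟨h4, h5, h1, h2, h3⟩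

/-- The coefficients tend to those of the free operator and have bounded variation. -/
structure Admissible (c : Coeffs) : Prop where
  tendsto_a_sub : Tendsto (fun n => c.a n - 1 / 2) atTop (𝓝 0)
  tendsto_b : Tendsto c.b atTop (𝓝 0)
  summable_increment : Summable c.increment

/-- The Jost solution exists near every point of the domain and depends continuously on the
spectral parameter. -/
theorem exists_local_jost (hc : c.Admissible) {s : Edge} {z₀ : ℂ} (hz₀ : z₀ ∈ s.domain) :
    ∃ U ∈ 𝓝[s.domain] z₀, ∃ G : ℂ → ℕ → ℂ,
      (∀ z ∈ U, c.IsJostSolution (c.zetaSeqExt s z) z (G z)) ∧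
      ∀ n, ContinuousOn (fun z => G z n) U := by
  obtain ⟨U, hU, hUs, N, δ, R, hδ, hδ1, hbd⟩ := exists_uniform_bounds hc.tendsto_a_sub hc.tendsto_b hz₀
  have hR : 0 ≤ R :=
    (norm_nonneg _).trans (hbd z₀ (mem_of_mem_nhdsWithin hz₀ hU) N le_rfl).1
  set κ : ℕ → ℝ := fun n => (16 * R + 4) / δ * c.increment n with hκ
  have hinc : ∀ n, 0 ≤ c.increment n := fun n => by unfold increment; positivity
  set M : ℂ → ℕ → ℂ × ℂ → ℂ × ℂ := fun z k =>
    jostStep (c.a (N + k + 1) / c.a (N + k)) (c.zetaSeqExt s z (N + k))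
      (c.zetaSeqExt s z (N + k + 1)) with hM
  have hstep : ∀ z ∈ U, ∀ k, ∀ X : ℂ × ℂ, ‖M z k X‖ ≤ (1 + 4 * κ (k + N) / δ ^ 2) * ‖X‖ ∧
      ‖M z k (1, 0) - (1, 0)‖ ≤ 4 * κ (k + N) / δ ^ 2 := by
    intro z hz k X
    rw [add_comm k N]
    obtain ⟨h1, h2, h3, h4, h5⟩ := hbd z hz (N + k) (by omega)
    obtain ⟨-, h2', h3', -, -⟩ := hbd z hz (N + k + 1) (by omega)
    refine norm_jostStep_le hδ hδ1 (c.norm_zetaSeqExt_le_one s z _)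
      (c.norm_zetaSeqExt_le_one s z _) h3' h4 ?_ (norm_zetaSeqExt_sub_le hδ h1 h2 h2' h5) X
    refine (norm_ratio_sub_one_le h2).trans ?_
    refine mul_le_mul_of_nonneg_right ?_ (hinc _)
    -- The bound 4 ≤ (16R + 4)/δ holds because R ≥ 0 and δ ≤ 1, so one κ covers both errors.
    rw [le_div_iff₀ hδ]
    nlinarith
  have hcs : ∀ n, ContinuousOn (fun z => c.zetaSeqExt s z n) U := fun n =>
    (c.continuousOn_zetaSeqExt s n).mono (hUs.trans s.domain_subset)
  have hne : ∀ z ∈ U, ∀ k, 1 - c.zetaSeqExt s z (N + k) ^ 2 ≠ 0 := fun z hz k =>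
    norm_pos_iff.1 (hδ.trans_le (hbd z hz (N + k) (by omega)).2.2.2.1)
  obtain ⟨X, hX1, hX2, hX3⟩ := exists_backward_solution U M ((1 : ℂ), (0 : ℂ))
    (ε := fun k => 4 * κ (k + N) / δ ^ 2)
    (by
      have h1 := hc.summable_increment
      exact (((((summable_nat_add_iff N).2 h1).mul_left _).mul_left 4).div_const _))
    (fun z hz k x y => by
      have := (hstep z hz k (x - y)).1
      rwa [hM, jostStep_sub])
    (fun z hz k => (hstep z hz k 0).2)
    (fun k x hx => by
      have h0 := hcs (N + k)
      have h1 := hcs (N + k + 1)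
      have hx1 : ContinuousOn (fun z => (x z).1) U := hx.fst
      have hx2 : ContinuousOn (fun z => (x z).2) U := hx.snd
      have hn2 : ∀ z ∈ U, c.zetaSeqExt s z (N + k + 1) ≠ 0 := fun z _ => c.zetaSeqExt_ne_zero s z _
      simp only [hM, jostStep]
      refine ContinuousOn.prodMk (ContinuousOn.div ?_ ?_ fun z hz => hne z hz k)
        (ContinuousOn.div ?_ ?_ fun z hz => hne z hz k)
      · exact ((((continuousOn_const.div h1 hn2).sub h0).mul hx1).add
          (((continuousOn_const.mul h1).sub h0).mul hx2)).mul h0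
      · exact continuousOn_const.sub (h0.pow 2)
      · exact (((continuousOn_const.sub ((continuousOn_const.mul h0).div h1 hn2)).mul hx1).add
          ((continuousOn_const.sub ((continuousOn_const.mul h0).mul h1)).mul hx2)).mul (h0.pow 2)
      · exact continuousOn_const.sub (h0.pow 2))
  -- The index j stands for n = j - 1, and the amplitudes at n have index n - N. For j ≤ N the
  -- truncated subtractions give meaningless values, which the extension below replaces.
  set g : ℂ → ℕ → ℂ := fun z j =>
    c.qExt s z (j - 1) * ((X z (j - 1 - N)).1 + (X z (j - 1 - N)).2) with hg
  have hgk : ∀ z k, g z (N + k + 1) = c.qExt s z (N + k) * ((X z k).1 + (X z k).2) := by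
    intro z k
    simp only [hg, Nat.add_sub_cancel, Nat.add_sub_cancel_left]
  obtain ⟨G, hG1, hG2, hG3⟩ := c.exists_isSolution_extension U (N + 1) g
    (fun z hz n hn => by
      obtain ⟨k, rfl⟩ := Nat.exists_eq_add_of_le hn
      have e1 := jostStep_fst_add_snd (ρ := c.a (N + k + 1) / c.a (N + k))
        (c.zetaSeqExt_ne_zero s z (N + k + 1)) (hne z hz k) (X z (k + 1))
      have e2 := jostStep_sq_fst_add_snd (ρ := c.a (N + (k + 1) + 1) / c.a (N + (k + 1)))
        (c.zetaSeqExt_ne_zero s z (N + (k + 1) + 1)) (hne z hz (k + 1)) (X z (k + 2))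
      have hXk : X z k = jostStep (c.a (N + k + 1) / c.a (N + k)) (c.zetaSeqExt s z (N + k))
        (c.zetaSeqExt s z (N + k + 1)) (X z (k + 1)) := hX1 z hz k
      have hXk1 : X z (k + 1) = jostStep (c.a (N + (k + 1) + 1) / c.a (N + (k + 1)))
        (c.zetaSeqExt s z (N + (k + 1))) (c.zetaSeqExt s z (N + (k + 1) + 1)) (X z (k + 2)) :=
        hX1 z hz (k + 1)
      rw [← hXk] at e1
      rw [← hXk1] at e2
      rw [show N + 1 + k = N + k + 1 by ring, show N + k + 1 + 1 = N + (k + 1) + 1 by ring,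
        show N + k + 1 + 2 = N + (k + 2) + 1 by ring, hgk, hgk, hgk,
        show N + (k + 2) = N + k + 1 + 1 by ring, show N + (k + 1) = N + k + 1 by ring,
        c.qExt_succ s z (N + k + 1), c.qExt_succ s z (N + k)]
      rw [show N + (k + 1) = N + k + 1 by ring] at e2
      have hq := c.zetaSeqExt_quadratic s z (N + k + 1)
      have hη := c.zetaSeqExt_ne_zero s z (N + k + 1)
      have ha0 := c.a_ne_zero (N + k)
      rw [e1]
      rw [show c.aPrev (N + k + 1) = c.a (N + k) from rfl]
      set η := c.zetaSeqExt s z (N + k + 1)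
      set ζ := c.zetaSeqExt s z (N + k)
      set Q := c.qExt s z (N + k)
      set x := (X z (k + 1)).1
      set y := (X z (k + 1)).2
      set u := (X z (k + 2)).1
      set v := (X z (k + 2)).2
      -- With n = N + k: after multiplication by η = ζ_{n+1}, `e1` supplies the term a_n f_n and
      -- `e2` the term a_{n+1} f_{n+2}; what remains is f_{n+1} times the quadratic equation for η.
      apply mul_left_cancel₀ hη
      have e3 : (c.a (N + k) : ℂ) * (Q * (c.a (N + k + 1) / c.a (N + k) * ζ * (x / η + η * y))) =
          Q * c.a (N + k + 1) * ζ * (x / η + η * y) := by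
        field_simp
      have e4 : η * (x / η + η * y) = x + η ^ 2 * y := by
        field_simp
      rw [e3]
      linear_combination Q * c.a (N + k + 1) * ζ * e4 - c.a (N + k + 1) * Q * ζ * e2 +
        Q * ζ * (x + y) * hq)
    (fun n hn => by
      obtain ⟨k, rfl⟩ := Nat.exists_eq_add_of_le hn
      rw [show N + 1 + k = N + k + 1 by ring]
      simp only [hgk]
      exact ((c.continuousOn_qExt s _).mono (hUs.trans s.domain_subset)).mul
        ((hX3 k).fst.add (hX3 k).snd))
  refine ⟨U, hU, G, fun z hz => ⟨hG1 z hz, ?_⟩, hG3⟩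
  have hlim : Tendsto (fun k => (X z k).1 + (X z k).2) atTop (𝓝 1) := by
    have h := hX2 z hz
    have := ((continuous_fst.tendsto _).comp h).add ((continuous_snd.tendsto _).comp h)
    simpa using this
  refine (tendsto_add_atTop_iff_nat N).1 (hlim.congr fun k => ?_)
  rw [hG2 z _ (by omega), show k + N + 1 = N + k + 1 by ring, hgk, add_comm k N]
  change _ = _ / c.qExt s z (N + k)
  rw [mul_div_cancel_left₀ _ (c.qExt_ne_zero s z _)]

/-- The Jost solution on a closed half-plane. -/
noncomputable def jostExt (c : Coeffs) (s : Edge) (z : ℂ) : ℕ → ℂ := c.jost (c.zetaSeqExt s z) z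

variable {s : Edge}

theorem existsUnique_isJostSolution (hc : c.Admissible) {z : ℂ} (hz : z ∈ s.domain) :
    ∃! f : ℕ → ℂ, c.IsJostSolution (c.zetaSeqExt s z) z f := by
  obtain ⟨U, hU, G, hG, -⟩ := exists_local_jost hc hz
  exact ⟨G z, hG z (mem_of_mem_nhdsWithin hz hU), fun g hg =>
    hg.unique (c.zetaSeqExt_ne_zero s z) (c.norm_zetaSeqExt_le_one s z)
      (hG z (mem_of_mem_nhdsWithin hz hU))⟩

theorem isJostSolution_jostExt (hc : c.Admissible) {z : ℂ} (hz : z ∈ s.domain) :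
    c.IsJostSolution (c.zetaSeqExt s z) z (c.jostExt s z) :=
  Classical.epsilon_spec (existsUnique_isJostSolution hc hz).exists

/-- By uniqueness the chosen solution coincides with the continuous local families. -/
theorem continuousOn_jostExt (hc : c.Admissible) (n : ℕ) : ContinuousOn (fun z => c.jostExt s z n) s.domain := by
  intro z hz
  obtain ⟨U, hU, G, hG, hGc⟩ := exists_local_jost hc hz
  have hzU := mem_of_mem_nhdsWithin hz hU
  have hev : ∀ z' ∈ U ∩ s.domain, c.jostExt s z' = G z' := fun z' hz' =>
    (isJostSolution_jostExt hc hz'.2).unique (c.zetaSeqExt_ne_zero s z')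
      (c.norm_zetaSeqExt_le_one s z') (hG z' hz'.1)
  have hU' : U ∩ s.domain ∈ 𝓝[s.domain] z := inter_mem hU self_mem_nhdsWithin
  have h1 : ContinuousWithinAt (fun z => G z n) (U ∩ s.domain) z :=
    (hGc n z hzU).mono inter_subset_left
  have h2 := h1.congr (fun z' hz' => congrFun (hev z' hz') n) (congrFun (hev z ⟨hzU, hz⟩) n)
  exact h2.mono_of_mem_nhdsWithin hU'

end Coeffs

/-! ### The functional calculus of a bounded self-adjoint operator -/

section FunctionalCalculus

variable {H : Type*} [NormedAddCommGroup H] [InnerProductSpace ℂ H] [CompleteSpace H]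
  {T : H →L[ℂ] H}

/-- The operator `f(T)`. -/
noncomputable def functionalCalculus (T : H →L[ℂ] H) (f : ℝ → ℝ) : H →L[ℂ] H := cfc f T

theorem functionalCalculus_mul_apply {f g : ℝ → ℝ} (hf : Continuous f) (hg : Continuous g) (v : H) :
    functionalCalculus T (fun x => f x * g x) v =
      functionalCalculus T f (functionalCalculus T g v) :=
  congrArg (fun A : H →L[ℂ] H => A v) (cfc_mul f g T hf.continuousOn hg.continuousOn)

theorem functionalCalculus_sub_apply {f g : ℝ → ℝ} (hf : Continuous f) (hg : Continuous g) (v : H) :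
    functionalCalculus T (fun x => f x - g x) v =
      functionalCalculus T f v - functionalCalculus T g v :=
  congrArg (fun A : H →L[ℂ] H => A v) (cfc_sub f g T hf.continuousOn hg.continuousOn)

theorem functionalCalculus_add_apply {f g : ℝ → ℝ} (hf : Continuous f) (hg : Continuous g) (v : H) :
    functionalCalculus T (fun x => f x + g x) v =
      functionalCalculus T f v + functionalCalculus T g v :=
  congrArg (fun A : H →L[ℂ] H => A v) (cfc_add (a := T) f g hf.continuousOn hg.continuousOn)

theorem functionalCalculus_const_apply (hT : IsSelfAdjoint T) (r : ℝ) (v : H) :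
    functionalCalculus T (fun _ => r) v = (r : ℂ) • v := by
  have h : functionalCalculus T (fun _ => r) = r • (1 : H →L[ℂ] H) := by
    rw [functionalCalculus, cfc_const r T, Algebra.algebraMap_eq_smul_one]
  rw [h]
  rfl

theorem functionalCalculus_const_mul_apply {f : ℝ → ℝ} (hf : Continuous f) (r : ℝ) (v : H) :
    functionalCalculus T (fun x => r * f x) v = (r : ℂ) • functionalCalculus T f v :=
  congrArg (fun A : H →L[ℂ] H => A v) (cfc_const_mul r f T hf.continuousOn)

theorem functionalCalculus_id_apply (hT : IsSelfAdjoint T) (v : H) :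
    functionalCalculus T (fun x => x) v = T v :=
  congrArg (fun A : H →L[ℂ] H => A v) (cfc_id' ℝ T)

theorem inner_functionalCalculus_left (f : ℝ → ℝ) (u v : H) :
    inner ℂ (functionalCalculus T f u) v = inner ℂ u (functionalCalculus T f v) :=
  ContinuousLinearMap.isSelfAdjoint_iff_isSymmetric.1 (cfc_predicate f T) u v

theorem norm_functionalCalculus_le {f : ℝ → ℝ} {r : ℝ} (hr : 0 ≤ r) (h : ∀ x, |f x| ≤ r) :
    ‖functionalCalculus T f‖ ≤ r :=
  norm_cfc_le hr fun x _ => h x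

/-- The quadratic form of the Poisson kernel, from a solution of the resolvent equation. -/
theorem inner_functionalCalculus_poisson (hT : IsSelfAdjoint T) {x ε σ : ℝ} {w : ℂ} {ψ v : H}
    (hε : 0 < ε) (hσ : σ * σ = 1) (hw : w ≠ 0)
    (hψ : T ψ = (x + (σ * ε : ℝ) * Complex.I : ℂ) • ψ + w • v) :
    inner ℂ v (functionalCalculus T (fun y : ℝ => ε / ((y - x) ^ 2 + ε ^ 2)) v) =
      ((ε * ‖ψ‖ ^ 2 / ‖w‖ ^ 2 : ℝ) : ℂ) := by
  set h := functionalCalculus T (fun y : ℝ => ε / ((y - x) ^ 2 + ε ^ 2)) with hh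
  set A := functionalCalculus T (fun y : ℝ => y - x) with hA
  have hpos : ∀ y : ℝ, (y - x) ^ 2 + ε ^ 2 ≠ 0 := fun y => by positivity
  have hhc : Continuous fun y : ℝ => ε / ((y - x) ^ 2 + ε ^ 2) :=
    Continuous.div (by fun_prop) (by fun_prop) hpos
  have hAc : Continuous fun y : ℝ => y - x := by fun_prop
  have hAJ : ∀ v, A v = T v - (x : ℂ) • v := by
    intro v
    rw [hA, functionalCalculus_sub_apply (by fun_prop) (by fun_prop),
      functionalCalculus_id_apply hT, functionalCalculus_const_apply hT]
  have hcomm : ∀ v, h (A v) = A (h v) := by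
    intro v
    rw [hA, hh, ← functionalCalculus_mul_apply hhc hAc, ← functionalCalculus_mul_apply hAc hhc]
    simp only [mul_comm]
  -- This is (A² + ε²)h = ε, from the same identity between functions of y.
  have hinv : ∀ v, A (A (h v)) + ((ε ^ 2 : ℝ) : ℂ) • h v = (ε : ℂ) • v := by
    intro v
    have h2 : Continuous fun y : ℝ => (y - x) * (ε / ((y - x) ^ 2 + ε ^ 2)) := hAc.mul hhc
    have h3 : Continuous fun y : ℝ => (y - x) * ((y - x) * (ε / ((y - x) ^ 2 + ε ^ 2))) :=
      hAc.mul h2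
    have h4 : Continuous fun y : ℝ => ε ^ 2 * (ε / ((y - x) ^ 2 + ε ^ 2)) :=
      continuous_const.mul hhc
    rw [hA, hh, ← functionalCalculus_mul_apply hAc hhc, ← functionalCalculus_mul_apply hAc h2,
      ← functionalCalculus_const_mul_apply hhc, ← functionalCalculus_add_apply h3 h4,
      ← functionalCalculus_const_apply hT]
    congr 2
    funext y
    have := hpos y
    field_simp
  have hψe : A ψ - ((σ * ε : ℝ) * Complex.I : ℂ) • ψ = w • v := by
    rw [hAJ, hψ, add_smul]
    abel
  -- Since w v = (A - iσε)ψ, moving one such factor across the inner product leaves ⟨ψ, (A² + ε²)hψ⟩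
  -- = ε‖ψ‖².
  have hquad : inner ℂ (w • v) (h (w • v)) = ((ε * ‖ψ‖ ^ 2 : ℝ) : ℂ) := by
    rw [← hψe, map_sub, map_smul, hcomm]
    have hsym : ∀ u v, inner ℂ (A u) v = inner ℂ u (A v) := inner_functionalCalculus_left _
    rw [inner_sub_left, hsym, inner_smul_left, ← inner_smul_right, ← inner_sub_right]
    have e1 : A (A (h ψ) - ((σ * ε : ℝ) * Complex.I : ℂ) • h ψ) -
        conj ((σ * ε : ℝ) * Complex.I : ℂ) •
          (A (h ψ) - ((σ * ε : ℝ) * Complex.I : ℂ) • h ψ) = (ε : ℂ) • ψ := by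
      rw [← hinv ψ, map_sub, map_smul, smul_sub, smul_smul]
      have e2 : conj ((σ * ε : ℝ) * Complex.I : ℂ) = -((σ * ε : ℝ) * Complex.I) := by
        rw [map_mul, Complex.conj_ofReal, Complex.conj_I, mul_neg]
      have e3 : (((σ * ε : ℝ) : ℂ) * Complex.I) * ((σ * ε : ℝ) * Complex.I) =
          -((ε ^ 2 : ℝ) : ℂ) := by
        have : (σ : ℂ) * σ = 1 := by exact_mod_cast hσ
        push_cast
        linear_combination (σ : ℂ) ^ 2 * ε ^ 2 * Complex.I_sq - (ε : ℂ) ^ 2 * this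
      rw [e2, neg_mul, e3, neg_neg, neg_smul]
      abel
    rw [e1, inner_smul_right, inner_self_eq_norm_sq_to_K]
    push_cast
    rfl
  rw [map_smul, inner_smul_left, inner_smul_right, ← mul_assoc, mul_comm (conj _),
    Complex.mul_conj'] at hquad
  have hw' : ((‖w‖ : ℝ) : ℂ) ^ 2 ≠ 0 := by
    exact_mod_cast pow_ne_zero 2 (norm_ne_zero_iff.2 hw)
  apply mul_left_cancel₀ hw'
  rw [hquad, ← Complex.ofReal_pow, ← Complex.ofReal_mul]
  congr 1
  have : ‖w‖ ≠ 0 := norm_ne_zero_iff.2 hw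
  field_simp

end FunctionalCalculus

/-! ### The Wronskian Ω on a closed half-plane -/

namespace Coeffs

variable {c : Coeffs} {s : Edge}

/-- The Wronskian `Ω` on a closed half-plane. -/
noncomputable def OmegaExt (c : Coeffs) (s : Edge) (z : ℂ) : ℂ := -(c.jostExt s z 0) / 2

/-- Evaluation at n = -1, where P_{-1} = 0, P_0 = 1 and a_{-1} = 1/2; this accounts for the form of
`OmegaExt`. -/
theorem wronskian_polySolution (z : ℂ) (f : ℕ → ℂ) :
    c.wronskian (c.polySolution z) f = -(f 0) / 2 := by
  simp only [wronskian, wronskianAt, aPrev, polySolution]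
  push_cast
  ring

theorem Omega_eq_OmegaExt {z : ℂ} (hz : z ∈ s.halfPlane) : c.Omega z = c.OmegaExt s z := by
  rw [Omega, wronskian_polySolution, OmegaExt, jostExt,
    c.zetaSeqExt_of_im_ne_zero s (Edge.im_ne_zero hz)]

theorem OmegaEdge_eq_OmegaExt (t : ℝ) : c.OmegaEdge s t = c.OmegaExt s t := by
  rw [OmegaEdge, wronskian_polySolution, OmegaExt, jostExt, c.zetaSeqExt_ofReal]

theorem continuousOn_OmegaExt (hc : c.Admissible) : ContinuousOn (c.OmegaExt s) s.domain :=
  (continuousOn_jostExt hc 0).neg.div_const 2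

/-! ### The boundary values on the cut -/

theorem tendsto_zetaSeqExt_apply (hc : c.Admissible) {z : ℂ} (hz : z ∈ s.domain) :
    Tendsto (c.zetaSeqExt s z) atTop (𝓝 (zetaExt s z)) := by
  have h : Tendsto (fun n : ℕ => (z, n)) atTop (𝓝[s.domain] z ×ˢ atTop) :=
    (tendsto_nhdsWithin_of_tendsto_nhds_of_eventually_within (fun _ : ℕ => z) tendsto_const_nhds
      (Eventually.of_forall fun _ => hz)).prodMk tendsto_id
  have h1 := (tendsto_zetaSeqExt hc.tendsto_a_sub hc.tendsto_b hz).comp h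
  simpa only [Function.comp_def] using h1

theorem eventually_norm_zetaSeqEdge (hc : c.Admissible) {t : ℝ} (ht : t ∈ Ioo (-1 : ℝ) 1) :
    ∀ᶠ n in atTop, ‖c.zetaSeqEdge s t n‖ = 1 := by
  have h1 : Tendsto (fun n => (t - c.b n) / (2 * c.a n)) atTop (𝓝 t) := by
    have := (hc.tendsto_b.const_sub t).div ((tendsto_a hc.tendsto_a_sub).const_mul 2) (by norm_num)
    simp at this
    exact this
  have h2 : |t| < 1 := abs_lt.2 ht
  filter_upwards [h1.abs.eventually_le_const h2] with n hn
  exact norm_zetaEdge_of_abs_le s hn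

theorem finite_mulSupport_norm_zetaSeqEdge (hc : c.Admissible) {t : ℝ} (ht : t ∈ Ioo (-1 : ℝ) 1) :
    (Function.mulSupport fun m : ℕ => ‖c.zetaSeqEdge s t m‖).Finite := by
  obtain ⟨N, hN⟩ := eventually_atTop.1 (eventually_norm_zetaSeqEdge (s := s) hc ht)
  refine (Set.finite_lt_nat N).subset fun n hn => ?_
  by_contra h
  exact hn (hN n (not_lt.1 h))

theorem eventually_norm_qExt (hc : c.Admissible) {t : ℝ} (ht : t ∈ Ioo (-1 : ℝ) 1) :
    ∀ᶠ n in atTop, ‖c.qExt s t n‖ = c.kFactor s t := by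
  obtain ⟨N, hN⟩ := eventually_atTop.1 (eventually_norm_zetaSeqEdge (s := s) hc ht)
  filter_upwards [eventually_ge_atTop N] with n hn
  rw [qExt, c.zetaSeqExt_ofReal, norm_prod, kFactor]
  refine (finprod_eq_prod_of_mulSupport_subset _ fun m hm => ?_).symm
  by_contra h
  have h' : n ≤ m := by simpa using h
  exact hm (hN m (hn.trans h'))

theorem kFactor_pos (t : ℝ) : 0 < c.kFactor s t := by
  refine finprod_induction (p := fun x : ℝ => 0 < x) one_pos (fun _ _ => mul_pos) fun m => ?_
  rw [← c.zetaSeqExt_ofReal]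
  exact norm_pos_iff.2 (c.zetaSeqExt_ne_zero s t m)

theorem IsSolution.conj {t : ℝ} {f : ℕ → ℂ} (hf : c.IsSolution t f) :
    c.IsSolution t fun n => conj (f n) := by
  intro n
  have h := congrArg conj (hf n)
  simpa using h

/-- For real t the conjugate of f is again a solution. Its Wronskian with f is i Im(conj f_{-1} ·
f_0) at n = -1, and at infinity it tends to ½k²(ζ - conj ζ) = -i · sign · k²√(1 - t²), since |q_n| =
k for large n. -/
theorem im_conj_jostExt_mul (hc : c.Admissible) {t : ℝ} (ht : t ∈ Ioo (-1 : ℝ) 1) :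
    (conj (c.jostExt s t 0) * c.jostExt s t 1).im =
      -(s.sign * c.kFactor s t ^ 2 * Real.sqrt (1 - t ^ 2)) := by
  have hD := s.ofReal_mem_domain ht
  obtain ⟨hf, hlim⟩ := isJostSolution_jostExt hc hD
  set f := c.jostExt s t with hfdef
  set u : ℕ → ℂ := fun n => f (n + 1) / c.qExt s t n with hu
  have hu1 : Tendsto u atTop (𝓝 1) := hlim
  have hu2 : Tendsto (fun n => u (n + 1)) atTop (𝓝 1) := (tendsto_add_atTop_iff_nat 1).2 hu1
  have hζ := tendsto_zetaSeqExt_apply hc hD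
  have haC : Tendsto (fun n => (c.a n : ℂ)) atTop (𝓝 ((1 / 2 : ℝ) : ℂ)) :=
    (Complex.continuous_ofReal.tendsto _).comp (tendsto_a hc.tendsto_a_sub)
  have hconj : ∀ {g : ℕ → ℂ} {l : ℂ}, Tendsto g atTop (𝓝 l) →
      Tendsto (fun n => conj (g n)) atTop (𝓝 (conj l)) := fun h =>
    (Complex.continuous_conj.tendsto _).comp h
  have hW : ∀ n, c.wronskianAt (fun n => conj (f n)) f (n + 1) =
      c.wronskianAt (fun n => conj (f n)) f 0 := fun n => c.wronskianAt_eq hf.conj hf _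
  have hWn : ∀ᶠ n in atTop, c.wronskianAt (fun n => conj (f n)) f (n + 1) =
      c.a n * (c.kFactor s t : ℂ) ^ 2 * (conj (u n) * u (n + 1) * c.zetaSeqExt s t n -
        conj (c.zetaSeqExt s t n) * conj (u (n + 1)) * u n) := by
    filter_upwards [eventually_norm_qExt (s := s) hc ht] with n hn
    have hq := c.qExt_ne_zero s t n
    have hq' := c.qExt_ne_zero s t (n + 1)
    have e1 : f (n + 1) = c.qExt s t n * u n := by rw [hu]; field_simp
    have e2 : f (n + 2) = c.qExt s t n * c.zetaSeqExt s t n * u (n + 1) := by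
      rw [← c.qExt_succ, hu]; field_simp
    have e3 : c.qExt s t n * conj (c.qExt s t n) = (c.kFactor s t : ℂ) ^ 2 := by
      rw [Complex.mul_conj', hn]
    rw [← e3]
    change (c.a n : ℂ) * (conj (f (n + 1)) * f (n + 2) - conj (f (n + 2)) * f (n + 1)) = _
    rw [e1, e2]
    simp only [map_mul]
    ring
  have hlimW := (haC.mul_const ((c.kFactor s t : ℂ) ^ 2)).mul
    ((((hconj hu1).mul hu2).mul hζ).sub (((hconj hζ).mul (hconj hu2)).mul hu1))
  have h0 := tendsto_nhds_unique (tendsto_const_nhds (x := c.wronskianAt (fun n => conj (f n)) f 0))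
    (hlimW.congr' (hWn.mono fun n hn => by rw [← hW n, hn]))
  rw [zetaExt_ofReal, zetaEdge_of_abs_le s (abs_lt.2 ht).le] at h0
  have h1 := congrArg Complex.im h0
  have h2 : (c.wronskianAt (fun n => conj (f n)) f 0).im = (conj (f 0) * f 1).im := by
    have e : c.wronskianAt (fun n => conj (f n)) f 0 =
        ((1 / 2 : ℝ) : ℂ) * (conj (f 0) * f 1 - conj (conj (f 0) * f 1)) := by
      simp only [wronskianAt, aPrev, map_mul, Complex.conj_conj]
      ring
    rw [e, Complex.im_ofReal_mul, Complex.sub_im, Complex.conj_im]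
    ring
  rw [h2] at h1
  rw [h1, ← Complex.ofReal_pow, ← Complex.ofReal_mul, Complex.im_ofReal_mul]
  simp
  ring

theorem OmegaExt_ofReal_ne_zero (hc : c.Admissible) {t : ℝ} (ht : t ∈ Ioo (-1 : ℝ) 1) :
    c.OmegaExt s t ≠ 0 := by
  intro h
  have h0 : c.jostExt s t 0 = 0 := by
    have := h
    unfold OmegaExt at this
    linear_combination -2 * this
  have h1 := im_conj_jostExt_mul (s := s) hc ht
  rw [h0, map_zero, zero_mul, Complex.zero_im, eq_comm, neg_eq_zero] at h1
  have h2 : 0 < 1 - t ^ 2 := by nlinarith [ht.1, ht.2]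
  have := s.sign_ne_zero
  have := (kFactor_pos (c := c) (s := s) t).ne'
  have := (Real.sqrt_pos.2 h2).ne'
  simp_all

theorem normOmega_ne_zero (hc : c.Admissible) {t : ℝ} (ht : t ∈ Ioo (-1 : ℝ) 1) :
    c.normOmega s t ≠ 0 := by
  rw [normOmega, OmegaEdge_eq_OmegaExt]
  exact mul_ne_zero (inv_ne_zero (by exact_mod_cast (kFactor_pos t).ne'))
    (OmegaExt_ofReal_ne_zero hc ht)

/-- The Weyl function `⟨(J - z)⁻¹ e₀, e₀⟩` on a closed half-plane. -/
noncomputable def weyl (c : Coeffs) (s : Edge) (z : ℂ) : ℂ := c.jostExt s z 1 / c.OmegaExt s z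

/-- As Ω = -f_{-1}/2, one has f_0/Ω = -½ conj(f_{-1}) f_0/|Ω|², whose imaginary part is given by
`im_conj_jostExt_mul`. The factor k² there is absorbed by the normalization of Ω. -/
theorem weight_eq_im_weyl (hc : c.Admissible) {t : ℝ} (ht : t ∈ Ioo (-1 : ℝ) 1) :
    c.weight s t = Real.pi⁻¹ * (s.sign * (c.weyl s t).im) := by
  have h1 := im_conj_jostExt_mul (s := s) hc ht
  have hΩ := OmegaExt_ofReal_ne_zero (s := s) hc ht
  have hk := kFactor_pos (c := c) (s := s) t
  have e1 : c.weyl s t =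
      ((‖c.OmegaExt s t‖ ^ 2)⁻¹ * (-1 / 2) : ℝ) * (conj (c.jostExt s t 0) * c.jostExt s t 1) := by
    have hc' : conj (c.OmegaExt s t) ≠ 0 := (map_ne_zero _).2 hΩ
    have h0 : conj (c.jostExt s t 0) = -2 * conj (c.OmegaExt s t) := by
      rw [OmegaExt, map_div₀, map_neg, Complex.conj_ofNat]
      ring
    rw [weyl, h0]
    push_cast
    rw [← Complex.mul_conj']
    field_simp
  rw [e1, Complex.im_ofReal_mul, h1, weight, normOmega, OmegaEdge_eq_OmegaExt, norm_mul, norm_inv,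
    Complex.norm_real, Real.norm_eq_abs, abs_of_pos hk]
  have h2 := s.sign_mul_self
  have h3 : ‖c.OmegaExt s t‖ ≠ 0 := norm_ne_zero_iff.2 hΩ
  have h4 := Real.pi_pos
  field_simp
  linear_combination -Real.sqrt (1 - t ^ 2) * h2

/-! ### The resolvent -/

theorem tendsto_jostExt_ratio (hc : c.Admissible) {z : ℂ} (hz : z ∈ s.domain) :
    Tendsto (fun n => c.jostExt s z (n + 2) / c.jostExt s z (n + 1)) atTop (𝓝 (zetaExt s z)) := by
  obtain ⟨-, hlim⟩ := isJostSolution_jostExt hc hz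
  have h1 := ((tendsto_add_atTop_iff_nat 1).2 hlim).div hlim one_ne_zero
  have h2 := h1.mul (tendsto_zetaSeqExt_apply hc hz)
  rw [div_one, one_mul] at h2
  refine h2.congr fun n => ?_
  have hq := c.qExt_ne_zero s z n
  have hζ := c.zetaSeqExt_ne_zero s z n
  change c.jostExt s z (n + 2) / c.qExt s z (n + 1) / (c.jostExt s z (n + 1) / c.qExt s z n) *
    c.zetaSeqExt s z n = _
  rw [c.qExt_succ]
  by_cases h : c.jostExt s z (n + 1) = 0
  · simp [h]
  · field_simp

/-- Ratio test: f_{n+1}/f_n → ζ(z), and |ζ(z)| < 1 off the real axis. -/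
theorem memℓp_jostExt (hc : c.Admissible) {z : ℂ} (hz : z ∈ s.halfPlane) :
    Memℓp (fun n => c.jostExt s z (n + 1)) 2 := by
  have hD := s.halfPlane_subset_domain hz
  refine memℓp_gen ?_
  simp only [ENNReal.toReal_ofNat, Real.rpow_ofNat]
  have hlt : ‖zetaExt s z‖ ^ 2 < 1 := by
    rw [zetaExt_of_im_ne_zero s (Edge.im_ne_zero hz)]
    have h1 := norm_zeta_lt_one (Edge.im_ne_zero hz)
    exact pow_lt_one₀ (norm_nonneg _) h1 two_ne_zero
  refine summable_of_ratio_test_tendsto_lt_one hlt ?_ ?_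
  · filter_upwards [(isJostSolution_jostExt hc hD).eventually_ne_zero] with n hn
    simpa using hn
  · refine ((tendsto_jostExt_ratio hc hD).norm.pow 2).congr fun n => ?_
    simp [div_pow]

/-- The square-summable Jost solution off the real axis. -/
noncomputable def jostVec (hc : c.Admissible) {z : ℂ} (hz : z ∈ s.halfPlane) : ell2 :=
  ⟨fun n => c.jostExt s z (n + 1), memℓp_jostExt hc hz⟩

theorem jostVec_apply (hc : c.Admissible) {z : ℂ} (hz : z ∈ s.halfPlane) (n : ℕ) :
    jostVec hc hz n = c.jostExt s z (n + 1) := rfl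

theorem jostVec_ne_zero (hc : c.Admissible) {z : ℂ} (hz : z ∈ s.halfPlane) :
    jostVec hc hz ≠ 0 := by
  intro h
  obtain ⟨n, hn⟩ :=
    (isJostSolution_jostExt hc (s.halfPlane_subset_domain hz)).eventually_ne_zero.exists
  apply hn
  rw [← jostVec_apply hc hz, h]
  rfl

theorem e_apply (n m : ℕ) : e n m = if m = n then 1 else 0 := by
  simp [e, lp.single_apply, Pi.single_apply]

/-- The matrix and the difference equation differ only at n = 0, where the matrix lacks a_{-1}f_{-1}
= -Ω. -/
theorem jacobiOp_jostVec (hc : c.Admissible) {z : ℂ} (hz : z ∈ s.halfPlane) :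
    c.jacobiOp (jostVec hc hz) = z • jostVec hc hz + c.OmegaExt s z • e 0 := by
  have hsol := (isJostSolution_jostExt hc (s.halfPlane_subset_domain hz)).1
  ext n
  rw [jacobiOp_apply, lp.coeFn_add, Pi.add_apply, lp.coeFn_smul, lp.coeFn_smul, Pi.smul_apply,
    Pi.smul_apply, e_apply, smul_eq_mul, smul_eq_mul]
  cases n with
  | zero =>
    have h := hsol 0
    simp only [matrixAction, jostVec_apply, OmegaExt]
    simp only [aPrev] at h
    push_cast at h
    simp only [zero_add, if_true, mul_one] at h ⊢
    linear_combination h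
  | succ n =>
    have h := hsol (n + 1)
    simp only [matrixAction, jostVec_apply]
    simp only [aPrev] at h
    simp only [Nat.add_eq_zero_iff, one_ne_zero, and_false, if_false, mul_zero, add_zero]
    exact h

theorem inner_e_left (n : ℕ) (u : ell2) : inner ℂ (e n) u = u n := by
  rw [e, lp.inner_single_left]
  simp

/-- ⟨ψ, Jψ⟩ is real; insert `jacobiOp_jostVec` and take imaginary parts. -/
theorem im_mul_norm_jostVec_sq (hc : c.Admissible) {z : ℂ} (hz : z ∈ s.halfPlane) :
    z.im * ‖jostVec hc hz‖ ^ 2 = -(c.OmegaExt s z * conj (c.jostExt s z 1)).im := by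
  set ψ := jostVec hc hz with hψ
  have h1 : (inner ℂ ψ (c.jacobiOp ψ)).im = 0 := by
    have h2 : inner ℂ (c.jacobiOp ψ) ψ = inner ℂ ψ (c.jacobiOp ψ) := c.jacobiLin_isSymmetric ψ ψ
    rw [← inner_conj_symm] at h2
    exact Complex.conj_eq_iff_im.1 h2
  rw [hψ, jacobiOp_jostVec, ← hψ, inner_add_right, inner_smul_right, inner_smul_right,
    inner_self_eq_norm_sq_to_K, ← inner_conj_symm ψ (e 0), inner_e_left, hψ, jostVec_apply, ← hψ,
    Complex.add_im] at h1
  have h3 : (z * ((‖ψ‖ : ℝ) : ℂ) ^ 2).im = z.im * ‖ψ‖ ^ 2 := by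
    rw [← Complex.ofReal_pow, Complex.im_mul_ofReal]
  change (z * ((‖ψ‖ : ℝ) : ℂ) ^ 2).im + _ = 0 at h1
  rw [h3] at h1
  linarith

/-- Off the real axis, Ω = 0 would make the Jost vector an eigenvector of J with a nonreal
eigenvalue. -/
theorem OmegaExt_ne_zero (hc : c.Admissible) {z : ℂ} (hz : z ∈ s.domain) : c.OmegaExt s z ≠ 0 := by
  by_cases h : z.im = 0
  · have hz' : z = (z.re : ℂ) := Complex.ext rfl (by simpa using h)
    rw [hz']
    exact OmegaExt_ofReal_ne_zero hc (abs_lt.1 (hz.2 h))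
  · have hz' : z ∈ s.halfPlane := lt_of_le_of_ne hz.1 (mul_ne_zero s.sign_ne_zero h).symm
    intro h0
    have h1 := im_mul_norm_jostVec_sq hc hz'
    rw [h0, zero_mul, Complex.zero_im, neg_zero] at h1
    have h2 := norm_ne_zero_iff.2 (jostVec_ne_zero hc hz')
    simp_all

theorem continuousOn_weyl (hc : c.Admissible) : ContinuousOn (c.weyl s) s.domain :=
  (continuousOn_jostExt hc 1).div (continuousOn_OmegaExt hc) fun _ hz => OmegaExt_ne_zero hc hz

theorem im_weyl (hc : c.Admissible) {z : ℂ} (hz : z ∈ s.halfPlane) :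
    (c.weyl s z).im = z.im * ‖jostVec hc hz‖ ^ 2 / ‖c.OmegaExt s z‖ ^ 2 := by
  have hΩ := OmegaExt_ne_zero hc (s.halfPlane_subset_domain hz)
  rw [im_mul_norm_jostVec_sq, weyl, Complex.div_im, Complex.sq_norm]
  simp
  ring

/-- The quadratic form of the imaginary part of the resolvent. -/
theorem inner_functionalCalculus_poisson (hc : c.Admissible) (x : ℝ) {ε : ℝ} (hε : 0 < ε) :
    inner ℂ (e 0) (functionalCalculus c.jacobiOp (fun y : ℝ => ε / ((y - x) ^ 2 + ε ^ 2)) (e 0)) =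
      ((s.sign * (c.weyl s (x + (s.sign * ε : ℝ) * Complex.I)).im : ℝ) : ℂ) := by
  set z : ℂ := x + (s.sign * ε : ℝ) * Complex.I with hzdef
  have hzim : z.im = s.sign * ε := by simp [hzdef]
  have hs := s.sign_mul_self
  have hz : z ∈ s.halfPlane := by
    change 0 < s.sign * z.im
    rw [hzim, ← mul_assoc, hs, one_mul]
    exact hε
  have hΩ := OmegaExt_ne_zero hc (s.halfPlane_subset_domain hz)
  rw [JacobiScattering.inner_functionalCalculus_poisson c.jacobiOp_isSelfAdjoint hε hs hΩ
    (jacobiOp_jostVec hc hz), im_weyl hc hz, hzim]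
  congr 1
  linear_combination -ε * ‖jostVec hc hz‖ ^ 2 / ‖c.OmegaExt s z‖ ^ 2 * hs

end Coeffs

/-! ### Poisson integrals -/

theorem integral_poisson_eq (φ : ℝ → ℝ) (y : ℝ) {ε : ℝ} (hε : 0 < ε) :
    ∫ x, φ x * (ε / ((y - x) ^ 2 + ε ^ 2)) = ∫ r, φ (y + ε * r) * (1 + r ^ 2)⁻¹ := by
  rw [← integral_add_left_eq_self (fun x => φ x * (ε / ((y - x) ^ 2 + ε ^ 2))) y]
  have h := Measure.integral_comp_mul_left
    (fun x => φ (y + x) * (ε / ((y - (y + x)) ^ 2 + ε ^ 2))) ε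
  rw [abs_of_pos (inv_pos.2 hε), smul_eq_mul, ← mul_right_inj' hε.ne', mul_inv_cancel_left₀ hε.ne',
    ← integral_const_mul] at h
  rw [← h]
  congr 1
  funext r
  field_simp
  ring

/-- Poisson integrals of a continuous compactly supported function converge uniformly. -/
theorem eventually_poisson_sub_le {φ : ℝ → ℝ} (hφ : Continuous φ) (hs : HasCompactSupport φ)
    {ε : ℕ → ℝ} (hε : ∀ k, 0 < ε k) (hε0 : Tendsto ε atTop (𝓝 0)) {δ : ℝ} (hδ : 0 < δ) :
    ∀ᶠ k in atTop, ∀ y,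
      |(∫ x, φ x * (ε k / ((y - x) ^ 2 + ε k ^ 2))) - Real.pi * φ y| ≤ δ := by
  classical
  obtain ⟨C, hC⟩ := hφ.bounded_above_of_compact_support hs
  have huc := hs.uniformContinuous_of_continuous hφ
  set D : ℕ → ℝ → ℝ := fun k y =>
    (∫ x, φ x * (ε k / ((y - x) ^ 2 + ε k ^ 2))) - Real.pi * φ y with hD
  have hDeq : ∀ k y, D k y = ∫ r, (φ (y + ε k * r) - φ y) * (1 + r ^ 2)⁻¹ := by
    intro k y
    have hi : ∀ f : ℝ → ℝ, Continuous f → (∀ x, ‖f x‖ ≤ C) →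
        Integrable fun r : ℝ => f r * (1 + r ^ 2)⁻¹ := fun f hf hfC =>
      integrable_inv_one_add_sq.bdd_mul hf.aestronglyMeasurable (Eventually.of_forall hfC)
    simp only [hD]
    rw [integral_poisson_eq φ y (hε k), mul_comm Real.pi, ← integral_univ_inv_one_add_sq,
      ← integral_const_mul, ← integral_sub]
    · simp only [sub_mul]
    · exact hi (fun r => φ (y + ε k * r)) (by fun_prop) fun r => hC _
    · exact hi (fun _ => φ y) continuous_const fun _ => hC y
  -- `Y k` is a point violating the bound δ, if there is one. Dominated convergence along these
  -- moving points, with uniform continuity of φ, then gives uniformity in y.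
  set Y : ℕ → ℝ := fun k => if h : ∃ y, δ < |D k y| then h.choose else 0 with hY
  have hlim : Tendsto (fun k => D k (Y k)) atTop (𝓝 0) := by
    have h0 : (0 : ℝ) = ∫ _ : ℝ, (0 : ℝ) := by simp
    rw [h0]
    simp only [hDeq]
    refine tendsto_integral_of_dominated_convergence (fun r => 2 * C * (1 + r ^ 2)⁻¹)
      (fun k => Continuous.aestronglyMeasurable ?_) (integrable_inv_one_add_sq.const_mul _)
      (fun k => Eventually.of_forall fun r => ?_) (Eventually.of_forall fun r => ?_)
    · refine Continuous.mul (by fun_prop) (Continuous.inv₀ (by fun_prop) fun r => ?_)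
      positivity
    · have h1 : (0 : ℝ) ≤ (1 + r ^ 2)⁻¹ := by positivity
      rw [norm_mul, Real.norm_of_nonneg h1]
      refine mul_le_mul_of_nonneg_right ((norm_sub_le _ _).trans ?_) h1
      have := hC (Y k + ε k * r)
      have := hC (Y k)
      linarith
    · have h1 : Tendsto (fun k => φ (Y k + ε k * r) - φ (Y k)) atTop (𝓝 0) := by
        rw [Metric.tendsto_atTop]
        intro η hη
        obtain ⟨θ, hθ, hθ'⟩ := Metric.uniformContinuous_iff.1 huc η hη
        have h2 := hε0.mul_const r
        rw [zero_mul] at h2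
        obtain ⟨N, hN⟩ := Metric.tendsto_atTop.1 h2 θ hθ
        refine ⟨N, fun k hk => ?_⟩
        have h3 := hN k hk
        have h4 := hθ' (show dist (Y k + ε k * r) (Y k) < θ by simpa [Real.dist_eq] using h3)
        simpa [Real.dist_eq] using h4
      simpa using h1.mul_const ((1 + r ^ 2)⁻¹)
  have hlim' := hlim.abs
  rw [abs_zero] at hlim'
  filter_upwards [hlim'.eventually_lt_const hδ] with k hk y
  by_contra hcon
  have hex : ∃ y, δ < |D k y| := ⟨y, not_le.1 hcon⟩
  have : Y k = hex.choose := by simp only [hY]; rw [dif_pos hex]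
  rw [this] at hk
  exact absurd hex.choose_spec (not_lt.2 hk.le)

/-! ### Stone's formula -/

section StoneFormula

variable {H : Type*} [NormedAddCommGroup H] [InnerProductSpace ℂ H] [CompleteSpace H]
  {T : H →L[ℂ] H}

theorem continuous_poisson_kernel {ε : ℝ} (hε : 0 < ε) :
    Continuous fun p : ℝ × ℝ => ε / ((p.2 - p.1) ^ 2 + ε ^ 2) :=
  Continuous.div (by fun_prop) (by fun_prop) fun p => by positivity

theorem poisson_kernel_le {ε : ℝ} (hε : 0 < ε) (u : ℝ) : |ε / (u ^ 2 + ε ^ 2)| ≤ ε⁻¹ := by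
  rw [abs_of_pos (by positivity), inv_eq_one_div, div_le_div_iff₀ (by positivity) hε]
  nlinarith [sq_nonneg u]

/-- The functional calculus commutes with integration over x, the integrand being dominated by
|φ(x)|/ε; the quadratic form at v is a continuous linear functional of the operator. -/
theorem integrable_inner_poisson {φ : ℝ → ℝ} (hT : IsSelfAdjoint T) (hφ : Continuous φ)
    (hs : HasCompactSupport φ) {ε : ℝ} (hε : 0 < ε) (v : H) :
    Integrable (fun x : ℝ => (φ x : ℂ) *
      inner ℂ v (functionalCalculus T (fun y : ℝ => ε / ((y - x) ^ 2 + ε ^ 2)) v)) ∧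
    inner ℂ v (functionalCalculus T
        (fun y => ∫ x, φ x * (ε / ((y - x) ^ 2 + ε ^ 2))) v) =
      ∫ x, (φ x : ℂ) *
        inner ℂ v (functionalCalculus T (fun y : ℝ => ε / ((y - x) ^ 2 + ε ^ 2)) v) := by
  have hk := continuous_poisson_kernel hε
  have hcont : Continuous (Function.uncurry fun x y : ℝ => φ x * (ε / ((y - x) ^ 2 + ε ^ 2))) :=
    (hφ.comp continuous_fst).mul hk
  have hbound : ∀ x y : ℝ, ‖φ x * (ε / ((y - x) ^ 2 + ε ^ 2))‖ ≤ |φ x| * ε⁻¹ := by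
    intro x y
    rw [norm_mul, Real.norm_eq_abs, Real.norm_eq_abs]
    exact mul_le_mul_of_nonneg_left (poisson_kernel_le hε _) (abs_nonneg _)
  have hbi : HasFiniteIntegral (fun x => |φ x| * ε⁻¹) :=
    ((hφ.integrable_of_hasCompactSupport hs).abs.mul_const _).2
  have hint : Integrable fun x : ℝ => cfc (fun y : ℝ => φ x * (ε / ((y - x) ^ 2 + ε ^ 2))) T :=
    integrable_cfc (fun x y : ℝ => φ x * (ε / ((y - x) ^ 2 + ε ^ 2))) (fun x => |φ x| * ε⁻¹) T
      hcont.continuousOn (Eventually.of_forall fun x y _ => hbound x y) hbi hT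
  have heq := cfc_integral (μ := volume) (fun x y : ℝ => φ x * (ε / ((y - x) ^ 2 + ε ^ 2)))
      (fun x => |φ x| * ε⁻¹) T
      hcont.continuousOn (Eventually.of_forall fun x y _ => hbound x y) hbi hT
  set L : (H →L[ℂ] H) →L[ℂ] ℂ := (innerSL ℂ v).comp (ContinuousLinearMap.apply ℂ H v) with hL
  have hLx : ∀ x : ℝ, L (cfc (fun y : ℝ => φ x * (ε / ((y - x) ^ 2 + ε ^ 2))) T) = (φ x : ℂ) *
      inner ℂ v (functionalCalculus T (fun y : ℝ => ε / ((y - x) ^ 2 + ε ^ 2)) v) := by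
    intro x
    have h1 := functionalCalculus_const_mul_apply (T := T)
      (f := fun y : ℝ => ε / ((y - x) ^ 2 + ε ^ 2)) (hk.comp (Continuous.prodMk_right x)) (φ x) v
    rw [← inner_smul_right, ← h1]
    rfl
  constructor
  · exact (L.integrable_comp hint).congr (Eventually.of_forall hLx)
  · calc _ = L (cfc (fun y => ∫ x, φ x * (ε / ((y - x) ^ 2 + ε ^ 2))) T) := rfl
      _ = L (∫ x, cfc (fun y : ℝ => φ x * (ε / ((y - x) ^ 2 + ε ^ 2))) T) := by rw [heq]
      _ = ∫ x, L (cfc (fun y : ℝ => φ x * (ε / ((y - x) ^ 2 + ε ^ 2))) T) :=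
        (L.integral_comp_comm hint).symm
      _ = _ := by simp only [hLx]

/-- Stone's formula: if the Poisson regularizations of the spectral measure of `v` converge
boundedly on the support of `φ`, then the limit is its density there. -/
theorem inner_functionalCalculus_eq_integral (hT : IsSelfAdjoint T) (v : H) {φ : ℝ → ℝ}
    (hφ : Continuous φ) (hs : HasCompactSupport φ) {ε : ℕ → ℝ} (hε : ∀ k, 0 < ε k)
    (hε0 : Tendsto ε atTop (𝓝 0)) {m : ℕ → ℝ → ℝ} {g : ℝ → ℝ} {B : ℝ}
    (hm : ∀ k x, inner ℂ v
      (functionalCalculus T (fun y : ℝ => ε k / ((y - x) ^ 2 + ε k ^ 2)) v) = (m k x : ℂ))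
    (hB : ∀ k, ∀ x ∈ tsupport φ, |m k x| ≤ B)
    (hg : ∀ x ∈ tsupport φ, Tendsto (fun k => m k x) atTop (𝓝 (Real.pi * g x))) :
    inner ℂ v (functionalCalculus T φ v) = ((∫ x, φ x * g x : ℝ) : ℂ) := by
  have hfm : ∀ k, Integrable (fun x => φ x * m k x) ∧ inner ℂ v (functionalCalculus T
      (fun y => ∫ x, φ x * (ε k / ((y - x) ^ 2 + ε k ^ 2))) v) =
        ((∫ x, φ x * m k x : ℝ) : ℂ) := by
    intro k
    obtain ⟨h1, h2⟩ := integrable_inner_poisson hT hφ hs (hε k) v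
    simp only [hm] at h1 h2
    refine ⟨?_, ?_⟩
    · refine h1.re.congr (Eventually.of_forall fun x => ?_)
      simp
    · rw [h2, ← integral_complex_ofReal]
      simp only [Complex.ofReal_mul]
  have hlim1 : Tendsto (fun k => ∫ x, φ x * m k x) atTop (𝓝 (∫ x, φ x * (Real.pi * g x))) := by
    refine tendsto_integral_of_dominated_convergence (fun x => |φ x| * B)
      (fun k => (hfm k).1.aestronglyMeasurable)
      ((hφ.integrable_of_hasCompactSupport hs).abs.mul_const _)
      (fun k => Eventually.of_forall fun x => ?_) (Eventually.of_forall fun x => ?_)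
    · by_cases hx : x ∈ tsupport φ
      · rw [norm_mul, Real.norm_eq_abs, Real.norm_eq_abs]
        exact mul_le_mul_of_nonneg_left (hB k x hx) (abs_nonneg _)
      · simp [image_eq_zero_of_notMem_tsupport hx]
    · by_cases hx : x ∈ tsupport φ
      · exact (hg x hx).const_mul _
      · simp [image_eq_zero_of_notMem_tsupport hx]
  have hcontk : ∀ k, Continuous fun y => ∫ x, φ x * (ε k / ((y - x) ^ 2 + ε k ^ 2)) := by
    intro k
    have hk := continuous_poisson_kernel (hε k)
    refine continuous_of_dominated (bound := fun x => |φ x| * (ε k)⁻¹) (fun y => ?_) (fun y => ?_)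
      ((hφ.integrable_of_hasCompactSupport hs).abs.mul_const _) (Eventually.of_forall fun x => ?_)
    · exact (hφ.mul (hk.comp (Continuous.prodMk_left y))).aestronglyMeasurable
    · refine Eventually.of_forall fun x => ?_
      rw [norm_mul, Real.norm_eq_abs, Real.norm_eq_abs]
      exact mul_le_mul_of_nonneg_left (poisson_kernel_le (hε k) _) (abs_nonneg _)
    · exact continuous_const.mul (hk.comp (Continuous.prodMk_right x))
  -- Second evaluation of the same limit: the Poisson integrals of φ tend to πφ uniformly, hence
  -- their functional calculi converge in operator norm.
  have hlim2 : Tendsto (fun k => inner ℂ v (functionalCalculus T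
      (fun y => ∫ x, φ x * (ε k / ((y - x) ^ 2 + ε k ^ 2))) v)) atTop
      (𝓝 ((Real.pi : ℂ) * inner ℂ v (functionalCalculus T φ v))) := by
    rw [Metric.tendsto_atTop]
    intro δ hδ
    -- The summand 1 covers v = 0.
    have hδ' : 0 < δ / (‖v‖ ^ 2 + 1) := by positivity
    obtain ⟨N, hN⟩ := eventually_atTop.1 (eventually_poisson_sub_le hφ hs hε hε0 hδ')
    refine ⟨N, fun k hk => ?_⟩
    have hπφ : Continuous fun x => Real.pi * φ x := continuous_const.mul hφ
    rw [dist_eq_norm, ← inner_smul_right, ← functionalCalculus_const_mul_apply hφ,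
      ← inner_sub_right, ← functionalCalculus_sub_apply (hcontk k) hπφ]
    have h1 := norm_functionalCalculus_le (T := T) hδ'.le (hN k hk)
    calc _ ≤ ‖v‖ * (δ / (‖v‖ ^ 2 + 1) * ‖v‖) := by
          refine (norm_inner_le_norm _ _).trans ?_
          refine mul_le_mul_of_nonneg_left ?_ (norm_nonneg _)
          exact (ContinuousLinearMap.le_opNorm _ _).trans
            (mul_le_mul_of_nonneg_right h1 (norm_nonneg _))
      _ = δ * (‖v‖ ^ 2 / (‖v‖ ^ 2 + 1)) := by ring
      _ < δ * 1 := by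
          refine mul_lt_mul_of_pos_left ?_ hδ
          rw [div_lt_one (by positivity)]
          linarith
      _ = δ := mul_one _
  have h3 := tendsto_nhds_unique hlim2
    (((Complex.continuous_ofReal.tendsto _).comp hlim1).congr fun k => (hfm k).2.symm)
  have hpi : (Real.pi : ℂ) ≠ 0 := by exact_mod_cast Real.pi_ne_zero
  apply mul_left_cancel₀ hpi
  rw [h3, ← Complex.ofReal_mul, ← integral_const_mul]
  congr 2
  funext x
  ring

/-! ### The spectral family as a strong limit -/

/-- A continuous approximation from above to the indicator function of `(-∞, t]`. -/
noncomputable def cutoff (j : ℕ) (t x : ℝ) : ℝ := 1 - min 1 ((j + 1) * max (x - t) 0)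

theorem continuous_cutoff (j : ℕ) (t : ℝ) : Continuous (cutoff j t) := by
  unfold cutoff
  fun_prop

theorem cutoff_nonneg (j : ℕ) (t x : ℝ) : 0 ≤ cutoff j t x :=
  sub_nonneg.2 (min_le_left _ _)

theorem cutoff_le_one (j : ℕ) (t x : ℝ) : cutoff j t x ≤ 1 := by
  have : 0 ≤ min (1 : ℝ) ((j + 1) * max (x - t) 0) :=
    le_min zero_le_one (mul_nonneg (by positivity) (le_max_right _ _))
  unfold cutoff
  linarith

theorem cutoff_of_le (j : ℕ) {t x : ℝ} (h : x ≤ t) : cutoff j t x = 1 := by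
  unfold cutoff
  rw [max_eq_right (by linarith)]
  simp

theorem cutoff_of_ge {j : ℕ} {t x : ℝ} (h : t + 1 / (j + 1) ≤ x) : cutoff j t x = 0 := by
  have hj : (0 : ℝ) < j + 1 := by positivity
  have h1 : 1 / ((j : ℝ) + 1) ≤ max (x - t) 0 := le_max_of_le_left (by linarith)
  rw [div_le_iff₀' hj] at h1
  rw [cutoff, min_eq_left h1, sub_self]

theorem tendsto_cutoff (t x : ℝ) :
    Tendsto (fun j => cutoff j t x) atTop (𝓝 ((Iic t).indicator 1 x)) := by
  by_cases h : x ≤ t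
  · simp [cutoff_of_le, h]
  · have h' := not_le.1 h
    rw [indicator_of_notMem (by simpa using h')]
    refine tendsto_const_nhds.congr' ?_
    filter_upwards [tendsto_one_div_add_atTop_nhds_zero_nat.eventually_lt_const (sub_pos.2 h')]
      with j hj
    exact (cutoff_of_ge (by linarith)).symm

theorem cutoff_mul_max_le (j : ℕ) (t x : ℝ) :
    |cutoff j t x * max (x - t) 0| ≤ 1 / ((j : ℝ) + 1) := by
  have hj : (0 : ℝ) < j + 1 := by positivity
  have h0 := cutoff_nonneg j t x
  have h1 := cutoff_le_one j t x
  have h2 : 0 ≤ max (x - t) 0 := le_max_right _ _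
  rw [abs_of_nonneg (mul_nonneg h0 h2)]
  by_cases h : t + 1 / (j + 1) ≤ x
  · rw [cutoff_of_ge h, zero_mul]
    positivity
  · have h3 : max (x - t) 0 ≤ 1 / ((j : ℝ) + 1) := max_le (by linarith) (by positivity)
    exact (mul_le_of_le_one_left h2 h1).trans h3

/-- With A = (T - t)₊, the vector u splits along ker A and its orthogonal complement. The cutoffs
act as the identity on ker A. On the range of A, dense in the complement since A is self-adjoint,
they tend to 0 by `cutoff_mul_max_le`; uniform boundedness extends this to the closure. -/
theorem tendsto_functionalCalculus_cutoff (hT : IsSelfAdjoint T) (t : ℝ) (u : H) :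
    Tendsto (fun j => functionalCalculus T (cutoff j t) u) atTop (𝓝 (spectralFamily T t u)) := by
  set pos : ℝ → ℝ := fun x => max (x - t) 0 with hpos
  have hposc : Continuous pos := by fun_prop
  set A := functionalCalculus T pos with hA
  have hAsa : IsSelfAdjoint A := cfc_predicate _ T
  have hker : ∀ v, A v = 0 → ∀ j, functionalCalculus T (cutoff j t) v = v := by
    intro v hv j
    have hmax : ∀ x, max 1 (((j : ℝ) + 1) * pos x) ≠ 0 := fun x =>
      (lt_of_lt_of_le one_pos (le_max_left _ _)).ne'
    have hh : Continuous fun x => ((j : ℝ) + 1) / max 1 ((j + 1) * pos x) :=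
      Continuous.div (by fun_prop) (by fun_prop) hmax
    -- Since min(1, u) = u/max(1, u), the function 1 - cutoff is a continuous multiple of (x - t)₊
    -- and annihilates ker A.
    have e1 : cutoff j t = fun x => 1 - ((j : ℝ) + 1) / max 1 ((j + 1) * pos x) * pos x := by
      funext x
      rw [cutoff, div_mul_eq_mul_div]
      congr 1
      rw [eq_div_iff (hmax x)]
      exact (min_mul_max _ _).trans (one_mul _)
    have hhp : Continuous fun x => ((j : ℝ) + 1) / max 1 ((j + 1) * pos x) * pos x := hh.mul hposc
    rw [e1, functionalCalculus_sub_apply continuous_const hhp,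
      functionalCalculus_const_apply hT, functionalCalculus_mul_apply hh hposc, ← hA, hv, map_zero]
    simp
  have hnorm : ∀ j, ‖functionalCalculus T (cutoff j t)‖ ≤ 1 := fun j =>
    norm_functionalCalculus_le zero_le_one fun x => by
      rw [abs_of_nonneg (cutoff_nonneg j t x)]
      exact cutoff_le_one j t x
  have hran : ∀ w ∈ A.kerᗮ, Tendsto (fun j => functionalCalculus T (cutoff j t) w) atTop (𝓝 0) := by
    intro w hw
    have hw' : w ∈ closure (A.range : Set H) := by
      have h1 := A.orthogonal_ker
      rw [hAsa.adjoint_eq] at h1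
      rw [h1] at hw
      exact hw
    rw [Metric.tendsto_atTop]
    intro δ hδ
    obtain ⟨_, ⟨w', rfl⟩, hw'⟩ := Metric.mem_closure_iff.1 hw' (δ / 2) (by positivity)
    have hlim := (tendsto_one_div_add_atTop_nhds_zero_nat (𝕜 := ℝ)).mul_const ‖w'‖
    rw [zero_mul] at hlim
    obtain ⟨N, hN⟩ := eventually_atTop.1 (hlim.eventually_lt_const (half_pos hδ))
    refine ⟨N, fun j hj => ?_⟩
    rw [dist_zero_right]
    have e1 : functionalCalculus T (cutoff j t) w =
        functionalCalculus T (cutoff j t) (w - A w') +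
          functionalCalculus T (fun x => cutoff j t x * pos x) w' := by
      rw [functionalCalculus_mul_apply (continuous_cutoff j t) hposc, map_sub, ← hA,
        sub_add_cancel]
    rw [e1]
    have h1 : ‖functionalCalculus T (cutoff j t) (w - A w')‖ < δ / 2 := by
      refine ((ContinuousLinearMap.le_opNorm _ _).trans
        (mul_le_of_le_one_left (norm_nonneg _) (hnorm j))).trans_lt ?_
      rwa [dist_eq_norm] at hw'
    have h2 : ‖functionalCalculus T (fun x => cutoff j t x * pos x) w'‖ < δ / 2 := by
      refine ((ContinuousLinearMap.le_opNorm _ _).trans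
        (mul_le_mul_of_nonneg_right (norm_functionalCalculus_le (by positivity)
          (cutoff_mul_max_le j t)) (norm_nonneg _))).trans_lt (hN j hj)
    exact (norm_add_le _ _).trans_lt (by linarith)
  have hP : A (spectralFamily T t u) = 0 := by
    have : spectralFamily T t u ∈ A.ker := Submodule.starProjection_apply_mem _ _
    exact this
  have hQ : u - spectralFamily T t u ∈ A.kerᗮ := Submodule.sub_starProjection_mem_orthogonal _
  have h := (hran _ hQ).add_const (spectralFamily T t u)
  rw [zero_add] at h
  refine h.congr fun j => ?_
  rw [map_sub, hker _ hP, sub_add_cancel]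

end StoneFormula

namespace Coeffs

variable {c : Coeffs} {s : Edge}

/-! ### The spectral density -/

theorem edge_point_mem_domain {x : ℝ} (hx : x ∈ Ioo (-1 : ℝ) 1) {ε : ℝ} (hε : 0 ≤ ε) :
    (x + (s.sign * ε : ℝ) * Complex.I : ℂ) ∈ s.domain := by
  have hs := s.sign_mul_self
  refine ⟨?_, fun _ => ?_⟩
  · have : s.sign * (s.sign * ε) = ε := by rw [← mul_assoc, hs, one_mul]
    simp [this, hε]
  · simpa [abs_lt] using hx

theorem continuousOn_weight (hc : c.Admissible) : ContinuousOn (c.weight s) (Ioo (-1) 1) := by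
  have h1 : ContinuousOn (fun x : ℝ => c.weyl s x) (Ioo (-1) 1) :=
    (continuousOn_weyl hc).comp Complex.continuous_ofReal.continuousOn
      fun x hx => s.ofReal_mem_domain hx
  have h2 : ContinuousOn (fun x : ℝ => Real.pi⁻¹ * (s.sign * (c.weyl s x).im)) (Ioo (-1) 1) :=
    continuousOn_const.mul (continuousOn_const.mul (Complex.continuous_im.comp_continuousOn h1))
  exact h2.congr fun x hx => weight_eq_im_weyl hc hx

theorem weight_nonneg (x : ℝ) : 0 ≤ c.weight s x := by
  unfold weight
  positivity

/-- The bound and the pointwise limit needed in Stone's formula both come from continuity of the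
Weyl function on the compact set of points x ± iε with x in the support of φ and 0 ≤ ε ≤ 1. -/
theorem inner_e_zero_functionalCalculus (hc : c.Admissible) (s : Edge) {φ : ℝ → ℝ}
    (hφ : Continuous φ) (hs : HasCompactSupport φ) (hsub : tsupport φ ⊆ Ioo (-1) 1) :
    inner ℂ (e 0) (functionalCalculus c.jacobiOp φ (e 0)) =
      ((∫ x, φ x * c.weight s x : ℝ) : ℂ) := by
  set pt : ℝ × ℝ → ℂ := fun p => p.1 + (s.sign * p.2 : ℝ) * Complex.I with hpt
  have hptc : Continuous pt := by fun_prop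
  have hmem : ∀ p ∈ tsupport φ ×ˢ Icc (0 : ℝ) 1, pt p ∈ s.domain := fun p hp =>
    edge_point_mem_domain (hsub hp.1) hp.2.1
  have hcontm : ContinuousOn (fun p => c.weyl s (pt p)) (tsupport φ ×ˢ Icc (0 : ℝ) 1) :=
    (continuousOn_weyl hc).comp hptc.continuousOn hmem
  obtain ⟨B, hB⟩ := (hs.isCompact.prod isCompact_Icc).exists_bound_of_continuousOn hcontm
  have hε : ∀ k : ℕ, (0 : ℝ) < 1 / ((k : ℝ) + 1) := fun k => by positivity
  have hε1 : ∀ k : ℕ, 1 / ((k : ℝ) + 1) ∈ Icc (0 : ℝ) 1 := fun k =>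
    ⟨(hε k).le, by rw [div_le_one (by positivity)]; linarith [k.cast_nonneg (α := ℝ)]⟩
  have hε0 := tendsto_one_div_add_atTop_nhds_zero_nat (𝕜 := ℝ)
  have hsign : |s.sign| = 1 := by cases s <;> simp [Edge.sign]
  refine inner_functionalCalculus_eq_integral c.jacobiOp_isSelfAdjoint (e 0) hφ hs hε hε0
    (m := fun k x => s.sign * (c.weyl s (pt (x, 1 / ((k : ℝ) + 1)))).im) (B := B)
    (fun k x => inner_functionalCalculus_poisson hc x (hε k)) (fun k x hx => ?_) (fun x hx => ?_)
  · rw [abs_mul, hsign, one_mul]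
    exact (Complex.abs_im_le_norm _).trans (hB (x, _) ⟨hx, hε1 k⟩)
  · rw [weight_eq_im_weyl hc (hsub hx), mul_inv_cancel_left₀ Real.pi_ne_zero]
    have h0 : pt (x, 0) = x := by simp [hpt]
    have h1 : Tendsto (fun k : ℕ => (x, 1 / ((k : ℝ) + 1))) atTop
        (𝓝[tsupport φ ×ˢ Icc (0 : ℝ) 1] (x, 0)) :=
      tendsto_nhdsWithin_of_tendsto_nhds_of_eventually_within _
        (tendsto_const_nhds.prodMk_nhds hε0) (Eventually.of_forall fun k => ⟨hx, hε1 k⟩)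
    have h2 := (hcontm (x, 0) ⟨hx, by simp⟩).tendsto.comp h1
    rw [h0] at h2
    exact ((Complex.continuous_im.tendsto _).comp h2).const_mul _

/-! ### The orthonormal polynomials and the canonical basis -/

/-- The polynomial solution at real spectral parameters. -/
noncomputable def polyReal (c : Coeffs) : ℕ → ℝ → ℝ
  | 0, _ => 0
  | 1, _ => 1
  | n + 2, x => (c.a n)⁻¹ * ((x * polyReal c (n + 1) x - c.b n * polyReal c (n + 1) x) -
      c.aPrev n * polyReal c n x)

theorem continuous_polyReal (k : ℕ) : Continuous (c.polyReal k) := by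
  induction k using Nat.twoStepInduction with
  | zero => exact continuous_const
  | one => exact continuous_const
  | more n h0 h1 =>
    change Continuous fun x => (c.a n)⁻¹ * ((x * polyReal c (n + 1) x -
      c.b n * polyReal c (n + 1) x) - c.aPrev n * polyReal c n x)
    fun_prop

theorem ofReal_polyReal (k : ℕ) (x : ℝ) : (c.polyReal k x : ℂ) = c.polySolution x k := by
  induction k using Nat.twoStepInduction with
  | zero => simp [polyReal, polySolution]
  | one => simp [polyReal, polySolution]
  | more n h0 h1 =>
    rw [polySolution, polyReal, ← h0, ← h1]
    push_cast
    rw [div_eq_inv_mul]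
    ring

/-- The canonical basis vector `e_{k-1}`, with `e_{-1} = 0`. -/
noncomputable def eShift : ℕ → ell2
  | 0 => 0
  | n + 1 => e n

theorem jacobiOp_eShift (n : ℕ) : c.jacobiOp (eShift (n + 1)) =
    (c.aPrev n : ℂ) • eShift n + (c.b n : ℂ) • eShift (n + 1) + (c.a n : ℂ) • eShift (n + 2) := by
  ext k
  rw [jacobiOp_apply, lp.coeFn_add, lp.coeFn_add, Pi.add_apply, Pi.add_apply, lp.coeFn_smul,
    lp.coeFn_smul, lp.coeFn_smul, Pi.smul_apply, Pi.smul_apply, Pi.smul_apply]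
  rcases n with _ | n <;> rcases k with _ | k
  · simp [matrixAction, eShift, e_apply]
  · rcases k with _ | k <;> simp [matrixAction, eShift, e_apply]
  · rcases n with _ | n <;> simp [matrixAction, eShift, e_apply, aPrev]
  · simp only [matrixAction, eShift, e_apply, aPrev, smul_eq_mul, mul_ite, mul_one, mul_zero]
    rcases lt_trichotomy k n with h | rfl | h
    · rcases (Nat.succ_le_of_lt h).eq_or_lt with rfl | h'
      · simp
        omega
      · have : k + 1 ≠ n := by omega
        have : k ≠ n := by omega
        have : k ≠ n + 1 := by omega
        have : k ≠ n + 2 := by omega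
        simp_all
    · simp
    · rcases (Nat.succ_le_of_lt h).eq_or_lt with rfl | h'
      · simp
        omega
      · have : k + 1 ≠ n := by omega
        have : k ≠ n := by omega
        have : k ≠ n + 1 := by omega
        simp_all

/-- P_n(J)e_0 and e_n obey the same three-term recursion with the same initial data 0 and e_0. -/
theorem functionalCalculus_polyReal (k : ℕ) :
    functionalCalculus c.jacobiOp (c.polyReal k) (e 0) = eShift k := by
  have hJ := c.jacobiOp_isSelfAdjoint
  induction k using Nat.twoStepInduction with
  | zero =>
    have h := functionalCalculus_const_apply hJ 0 (e 0)
    rw [Complex.ofReal_zero, zero_smul] at h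
    exact h
  | one =>
    have h := functionalCalculus_const_apply hJ 1 (e 0)
    rw [Complex.ofReal_one, one_smul] at h
    exact h
  | more n h0 h1 =>
    have c0 := continuous_polyReal (c := c) n
    have c1 := continuous_polyReal (c := c) (n + 1)
    have cx : Continuous fun x => x * c.polyReal (n + 1) x := continuous_id.mul c1
    have cb : Continuous fun x => c.b n * c.polyReal (n + 1) x := continuous_const.mul c1
    have ca : Continuous fun x => c.aPrev n * c.polyReal n x := continuous_const.mul c0
    have cd : Continuous fun x => x * c.polyReal (n + 1) x - c.b n * c.polyReal (n + 1) x :=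
      cx.sub cb
    have ce : Continuous fun x => (x * c.polyReal (n + 1) x - c.b n * c.polyReal (n + 1) x) -
      c.aPrev n * c.polyReal n x := cd.sub ca
    change functionalCalculus c.jacobiOp (fun x => (c.a n)⁻¹ *
      ((x * c.polyReal (n + 1) x - c.b n * c.polyReal (n + 1) x) - c.aPrev n * c.polyReal n x))
      (e 0) = _
    rw [functionalCalculus_const_mul_apply ce, functionalCalculus_sub_apply cd ca,
      functionalCalculus_sub_apply cx cb, functionalCalculus_const_mul_apply c1,
      functionalCalculus_const_mul_apply c0, functionalCalculus_mul_apply continuous_id' c1,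
      functionalCalculus_id_apply hJ, h0, h1, jacobiOp_eShift]
    have h2 : (((c.a n)⁻¹ : ℝ) : ℂ) * c.a n = 1 := by
      rw [Complex.ofReal_inv, inv_mul_cancel₀ (c.a_ne_zero n)]
    have h3 : (c.aPrev n : ℂ) • eShift n + (c.b n : ℂ) • eShift (n + 1) +
        (c.a n : ℂ) • eShift (n + 2) - (c.b n : ℂ) • eShift (n + 1) - (c.aPrev n : ℂ) • eShift n =
        (c.a n : ℂ) • eShift (n + 2) := by abel
    rw [h3, smul_smul, h2, one_smul]

/-- The density of the spectral family in the canonical basis, as a real function. -/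
noncomputable def density (c : Coeffs) (s : Edge) (n m : ℕ) (x : ℝ) : ℝ :=
  c.weight s x * c.polyReal (n + 1) x * c.polyReal (m + 1) x

theorem continuousOn_density (hc : c.Admissible) (n m : ℕ) :
    ContinuousOn (c.density s n m) (Ioo (-1) 1) :=
  ((continuousOn_weight hc).mul (continuous_polyReal _).continuousOn).mul
    (continuous_polyReal _).continuousOn

/-- Writing e_n = P_n(J)e_0 and e_m = P_m(J)e_0 reduces the claim to the vector e_0 and the test
function P_m φ P_n, supported where φ is. -/
theorem inner_e_functionalCalculus (hc : c.Admissible) (s : Edge) (n m : ℕ) {φ : ℝ → ℝ}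
    (hφ : Continuous φ) (hs : HasCompactSupport φ) (hsub : tsupport φ ⊆ Ioo (-1) 1) :
    inner ℂ (e m) (functionalCalculus c.jacobiOp φ (e n)) =
      ((∫ x, φ x * c.density s n m x : ℝ) : ℂ) := by
  have hn := functionalCalculus_polyReal (c := c) (n + 1)
  have hm := functionalCalculus_polyReal (c := c) (m + 1)
  have cn := continuous_polyReal (c := c) (n + 1)
  have cm := continuous_polyReal (c := c) (m + 1)
  have cφ : Continuous fun x => φ x * c.polyReal (n + 1) x := hφ.mul cn
  change inner ℂ (eShift (m + 1)) (functionalCalculus c.jacobiOp φ (eShift (n + 1))) = _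
  rw [← hn, ← hm, inner_functionalCalculus_left, ← functionalCalculus_mul_apply hφ cn,
    ← functionalCalculus_mul_apply cm cφ]
  have hsupp : Function.support (fun x => c.polyReal (m + 1) x * (φ x * c.polyReal (n + 1) x)) ⊆
      Function.support φ := by
    intro x hx h
    exact hx (by simp [h])
  have cψ : Continuous fun x => c.polyReal (m + 1) x * (φ x * c.polyReal (n + 1) x) := cm.mul cφ
  rw [inner_e_zero_functionalCalculus hc s cψ (hs.mono hsupp)
    ((closure_mono hsupp).trans hsub)]
  congr 2
  funext x
  unfold density
  ring

/-- The increments of the spectral family inside `(-1, 1)`. -/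
theorem inner_spectralFamily_sub (hc : c.Admissible) (s : Edge) (n m : ℕ) {α β : ℝ} (hα : -1 < α)
    (hαβ : α ≤ β) (hβ : β < 1) :
    inner ℂ (e m) (spectralFamily c.jacobiOp β (e n)) -
      inner ℂ (e m) (spectralFamily c.jacobiOp α (e n)) =
      ((∫ x in α..β, c.density s n m x : ℝ) : ℂ) := by
  have hJ := c.jacobiOp_isSelfAdjoint
  -- The cutoff at β extends to the right of β; γ < 1 leaves room, so that for large j the
  -- difference of cutoffs is supported in [α, γ].
  obtain ⟨γ, hβγ, hγ⟩ := exists_between hβ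
  set φ : ℕ → ℝ → ℝ := fun j x => cutoff j β x - cutoff j α x with hφ
  have hφc : ∀ j, Continuous (φ j) := fun j => (continuous_cutoff j β).sub (continuous_cutoff j α)
  have hlim : Tendsto (fun j => inner ℂ (e m) (functionalCalculus c.jacobiOp (φ j) (e n))) atTop
      (𝓝 (inner ℂ (e m) (spectralFamily c.jacobiOp β (e n)) -
        inner ℂ (e m) (spectralFamily c.jacobiOp α (e n)))) := by
    rw [← inner_sub_right]
    refine Tendsto.inner tendsto_const_nhds
      (((tendsto_functionalCalculus_cutoff hJ β (e n)).sub
        (tendsto_functionalCalculus_cutoff hJ α (e n))).congr fun j => ?_)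
    rw [← functionalCalculus_sub_apply (continuous_cutoff j β) (continuous_cutoff j α)]
  have hsub : ∀ᶠ j in atTop, Function.support (φ j) ⊆ Icc α γ := by
    filter_upwards [(tendsto_one_div_add_atTop_nhds_zero_nat (𝕜 := ℝ)).eventually_lt_const
      (sub_pos.2 hβγ)] with j hj x hx
    by_contra hcon
    apply hx
    simp only [hφ]
    rw [mem_Icc, not_and_or, not_le, not_le] at hcon
    rcases hcon with h | h
    · rw [cutoff_of_le j h.le, cutoff_of_le j (h.le.trans hαβ), sub_self]
    · rw [cutoff_of_ge (by linarith), cutoff_of_ge (by linarith), sub_self]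
  have hIcc : Icc α γ ⊆ Ioo (-1) 1 := fun x hx => ⟨hα.trans_le hx.1, hx.2.trans_lt hγ⟩
  have hint : IntegrableOn (c.density s n m) (Icc α γ) :=
    ((continuousOn_density hc n m).mono hIcc).integrableOn_Icc
  have heq : ∀ᶠ j in atTop, ((∫ x in Icc α γ, φ j x * c.density s n m x : ℝ) : ℂ) =
      inner ℂ (e m) (functionalCalculus c.jacobiOp (φ j) (e n)) := by
    filter_upwards [hsub] with j hj
    have hts : tsupport (φ j) ⊆ Icc α γ := closure_minimal hj isClosed_Icc
    rw [inner_e_functionalCalculus hc s n m (hφc j)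
      (HasCompactSupport.of_support_subset_isCompact isCompact_Icc hj) (hts.trans hIcc),
      setIntegral_eq_integral_of_forall_compl_eq_zero]
    intro x hx
    have : φ j x = 0 := by
      by_contra h
      exact hx (hj h)
    rw [this, zero_mul]
  have hdct : Tendsto (fun j => ∫ x in Icc α γ, φ j x * c.density s n m x) atTop
      (𝓝 (∫ x in Icc α γ, (Ioc α β).indicator (c.density s n m) x)) := by
    refine tendsto_integral_of_dominated_convergence (fun x => |c.density s n m x|)
      (fun j => (hφc j).aestronglyMeasurable.mul hint.aestronglyMeasurable) hint.abs
      (fun j => Eventually.of_forall fun x => ?_) (Eventually.of_forall fun x => ?_)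
    · rw [norm_mul, Real.norm_eq_abs, Real.norm_eq_abs]
      refine mul_le_of_le_one_left (abs_nonneg _) ?_
      have h1 := cutoff_nonneg j β x
      have h2 := cutoff_nonneg j α x
      have h3 := cutoff_le_one j β x
      have h4 := cutoff_le_one j α x
      exact abs_le.2 ⟨by simp only [hφ]; linarith, by simp only [hφ]; linarith⟩
    · have h := ((tendsto_cutoff β x).sub (tendsto_cutoff α x)).mul_const (c.density s n m x)
      convert h using 2
      by_cases h1 : x ≤ α
      · have h2 : x ≤ β := h1.trans hαβ
        simp [indicator, h1, h2, not_lt.2 h1]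
      · by_cases h2 : x ≤ β <;> simp [indicator, h1, h2, not_le.1 h1]
  have h1 := tendsto_nhds_unique hlim
    (((Complex.continuous_ofReal.tendsto _).comp hdct).congr' heq)
  rw [h1, setIntegral_indicator measurableSet_Ioc, intervalIntegral.integral_of_le hαβ,
    inter_eq_right.2 (Ioc_subset_Icc_self.trans (Icc_subset_Icc_right hβγ.le))]

theorem hasDerivAt_spectralFamily (hc : c.Admissible) (s : Edge) (n m : ℕ) {t : ℝ}
    (ht : t ∈ Ioo (-1 : ℝ) 1) :
    HasDerivAt (fun x : ℝ => inner ℂ (e m) (spectralFamily c.jacobiOp x (e n)))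
      (c.density s n m t : ℂ) t := by
  obtain ⟨α, hα, hαt⟩ := exists_between ht.1
  have hcont := continuousOn_density (s := s) hc n m
  have hint : IntervalIntegrable (c.density s n m) volume α t := by
    refine ContinuousOn.intervalIntegrable (hcont.mono ?_)
    rw [uIcc_of_le hαt.le]
    exact fun x hx => ⟨hα.trans_le hx.1, hx.2.trans_lt ht.2⟩
  have h1 := intervalIntegral.integral_hasDerivAt_right hint
    (hcont.stronglyMeasurableAtFilter isOpen_Ioo t ht) (hcont.continuousAt (isOpen_Ioo.mem_nhds ht))
  have h2 := h1.ofReal_comp.const_add (inner ℂ (e m) (spectralFamily c.jacobiOp α (e n)))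
  refine h2.congr_of_eventuallyEq ?_
  filter_upwards [Ioo_mem_nhds hαt ht.2] with x hx
  rw [← inner_spectralFamily_sub hc s n m hα hx.1.le hx.2]
  ring

theorem density_zero (x : ℝ) : c.density s 0 0 x = c.weight s x := by
  simp [density, polyReal]

theorem spectralMeasure_Ioc (hc : c.Admissible) (s : Edge) {α β : ℝ} (hα : -1 < α) (hβ : β < 1) :
    c.spectralMeasure (Ioc α β) = ∫⁻ x in Ioc α β, ENNReal.ofReal (c.weight s x) := by
  rcases lt_or_ge α β with hαβ | hαβ
  · have hst : ∀ x ∈ Ioo (-1 : ℝ) 1,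
        (spectralFamily_mono c.jacobiOp (e 0)).stieltjesFunction x =
          (inner ℂ (e 0) (spectralFamily c.jacobiOp x (e 0))).re := by
      intro x hx
      rw [Monotone.stieltjesFunction_eq]
      have h1 := (hasDerivAt_spectralFamily hc s 0 0 hx).continuousAt
      have h2 : ContinuousAt
          (fun t : ℝ => RCLike.re (inner ℂ (e 0) (spectralFamily c.jacobiOp t (e 0)))) x :=
        Complex.continuous_re.continuousAt.comp h1
      exact h2.continuousWithinAt.rightLim_eq
    have hint : IntegrableOn (c.weight s) (Ioc α β) :=
      (((continuousOn_weight hc).mono fun x hx =>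
        (⟨hα.trans_le hx.1, hx.2.trans_lt hβ⟩ : x ∈ Ioo (-1 : ℝ) 1)).integrableOn_Icc).mono_set
        Ioc_subset_Icc_self
    have hinc := congrArg Complex.re (inner_spectralFamily_sub hc s 0 0 hα hαβ.le hβ)
    rw [Complex.sub_re, Complex.ofReal_re] at hinc
    rw [spectralMeasure, spectralMeasureOf, StieltjesFunction.measure_Ioc,
      hst β ⟨hα.trans hαβ, hβ⟩, hst α ⟨hα, hαβ.trans hβ⟩, hinc,
      intervalIntegral.integral_of_le hαβ.le]
    simp only [density_zero]
    exact ofReal_integral_eq_lintegral_ofReal hint (Eventually.of_forall fun x => weight_nonneg x)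
  · simp [Ioc_eq_empty_of_le hαβ]

theorem spectralMeasure_restrict (hc : c.Admissible) (s : Edge) :
    c.spectralMeasure.restrict (Ioo (-1) 1) =
      (volume.restrict (Ioo (-1 : ℝ) 1)).withDensity fun t => ENNReal.ofReal (c.weight s t) := by
  rw [← restrict_withDensity measurableSet_Ioo]
  -- `spectralMeasure_Ioc` needs endpoints away from ±1, so the interval is exhausted from inside.
  have hU : Ioo (-1 : ℝ) 1 = ⋃ k : ℕ, Ioc (-1 + 1 / ((k : ℝ) + 1)) (1 - 1 / ((k : ℝ) + 1)) := by
    ext x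
    simp only [mem_iUnion]
    constructor
    · intro hx
      have h := tendsto_one_div_add_atTop_nhds_zero_nat (𝕜 := ℝ)
      obtain ⟨k, h1, h2⟩ := ((h.eventually_lt_const (show 0 < x + 1 by linarith [hx.1])).and
        (h.eventually_lt_const (show 0 < 1 - x by linarith [hx.2]))).exists
      exact ⟨k, by linarith, by linarith⟩
    · rintro ⟨k, h1, h2⟩
      have : (0 : ℝ) < 1 / ((k : ℝ) + 1) := by positivity
      exact ⟨by linarith, by linarith⟩
  rw [hU, Measure.restrict_iUnion_congr]
  intro k
  have hk : (0 : ℝ) < 1 / ((k : ℝ) + 1) := by positivity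
  have : IsLocallyFiniteMeasure c.spectralMeasure := by
    unfold spectralMeasure spectralMeasureOf
    infer_instance
  refine Measure.ext_of_Ioc _ _ fun a b _ => ?_
  rw [Measure.restrict_apply measurableSet_Ioc, Measure.restrict_apply measurableSet_Ioc,
    Ioc_inter_Ioc, withDensity_apply _ measurableSet_Ioc]
  exact spectralMeasure_Ioc hc s (lt_max_of_lt_right (by linarith))
    (min_lt_of_right_lt (by linarith))

end Coeffs

end JacobiScattering

/-! ### The main theorem -/

theorem theorem5p6 (c : Coeffs)
    (ha : Tendsto (fun n => c.a n - 1 / 2) atTop (𝓝 0))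
    (hb : Tendsto c.b atTop (𝓝 0))
    (hab : Summable fun n => |c.a (n + 1) - c.a n| + |c.b (n + 1) - c.b n|) :
    -- the Jost solution exists and is unique off the real axis
    (∀ z : ℂ, z.im ≠ 0 → ∃! f : ℕ → ℂ, c.IsJostSolution (c.zetaSeq z) z f) ∧
    -- and on both edges of the cut, where `Ω` takes its boundary values, which are nonzero
    (∀ (s : Edge), ∀ t ∈ Ioo (-1 : ℝ) 1,
      (∃! f : ℕ → ℂ, c.IsJostSolution (c.zetaSeqEdge s t) t f) ∧
      Tendsto c.Omega (𝓝[s.halfPlane] (t : ℂ)) (𝓝 (c.OmegaEdge s t)) ∧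
      (Function.mulSupport fun m : ℕ => ‖c.zetaSeqEdge s t m‖).Finite ∧
      c.normOmega s t ≠ 0) ∧
    -- the formula for the spectral family
    (∀ (s : Edge) (n m : ℕ), ∀ t ∈ Ioo (-1 : ℝ) 1,
      HasDerivAt (fun x : ℝ => inner ℂ (e m) (spectralFamily c.jacobiOp x (e n)))
        ((((2 * Real.pi)⁻¹ * Real.sqrt (1 - t ^ 2) * (‖c.normOmega s t‖ ^ 2)⁻¹ : ℝ) : ℂ) *
          c.P n t * c.P m t) t) ∧
    -- the spectral measure on the interval `(-1, 1)`
    (∀ s : Edge, c.spectralMeasure.restrict (Ioo (-1) 1) =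
      (volume.restrict (Ioo (-1 : ℝ) 1)).withDensity fun t => ENNReal.ofReal (c.weight s t)) := by
  have hc : c.Admissible := ⟨ha, hb, hab⟩
  refine ⟨fun z hz => ?_, fun s t ht => ⟨?_, ?_, ?_, ?_⟩, fun s n m t ht => ?_,
    fun s => Coeffs.spectralMeasure_restrict hc s⟩
  · obtain ⟨s, hs⟩ : ∃ s : Edge, z ∈ s.halfPlane := by
      rcases lt_or_gt_of_ne hz with h | h
      · exact ⟨.lower, by change 0 < (-1 : ℝ) * z.im; linarith⟩
      · exact ⟨.upper, by change 0 < (1 : ℝ) * z.im; linarith⟩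
    rw [← c.zetaSeqExt_of_im_ne_zero s hz]
    exact Coeffs.existsUnique_isJostSolution hc (s.halfPlane_subset_domain hs)
  · rw [← c.zetaSeqExt_ofReal]
    exact Coeffs.existsUnique_isJostSolution hc (s.ofReal_mem_domain ht)
  · rw [Coeffs.OmegaEdge_eq_OmegaExt]
    have h := (Coeffs.continuousOn_OmegaExt hc t (s.ofReal_mem_domain ht)).mono
      s.halfPlane_subset_domain
    refine h.tendsto.congr' ?_
    filter_upwards [self_mem_nhdsWithin] with z hz
    exact (Coeffs.Omega_eq_OmegaExt hz).symm
  · exact Coeffs.finite_mulSupport_norm_zetaSeqEdge hc ht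
  · exact Coeffs.normOmega_ne_zero hc ht
  · have h := Coeffs.hasDerivAt_spectralFamily hc s n m ht
    rw [Coeffs.density, Complex.ofReal_mul, Complex.ofReal_mul, Coeffs.ofReal_polyReal,
      Coeffs.ofReal_polyReal] at h
    exact h
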